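/- **Setting.** Let $d\ge 1$ and let $D\subset[0,1]^d$ be a non-empty open convex polytopal domain. Let $C:\mathbb R^d\to\mathbb R$ be even in each coordinate, and suppose that $C(x-y)$ is the covariance function of a centred stationary Gaussian random field $Z$ on $\bar D$ with almost surely continuous sample paths. Let $f\in H^{-1}(D)=(H^1_0(D))^*$. The norm of $H^1(D)$ is $\|v\|_{H^1(D)}=(\|v\|_{L^2}^2+\|\nabla v\|_{L^2}^2)^{1/2}$, and $H^1_0(D)$ is the closure of $C_c^\infty(D)$ in $H^1(D)$. **Samples.** Let $m_1,\dots,m_d\ge1$ and let $\mathcal T$ be the uniform grid of points $x_p=(p_1/m_1,\dots,p_d/m_d)$, $0\le p_i\le m_i$. Let $J_1,\dots,J_d\ge 0$ be padding parameters, let $C^{\mathrm{ext}}$ be a function on $\mathbb R^d$ which equals $C$ on $[0,1]^d$, and let $s=\prod_i 2(m_i+J_i)$. The embedding matrix is the $s\times s$ block circulant matrix $$S_{pq}=C^{\mathrm{ext}}\Big(\big(\tfrac{\min(a_i,\,2(m_i+J_i)-a_i)}{m_i}\big)_{i}\Big),\qquad a_i=|p_i-q_i|,\qquad 0\le p_i,q_i<2(m_i+J_i),$$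 and it is assumed to be positive semidefinite. Let $F$ be the $d$-dimensional unitary discrete Fourier matrix, $F_{pq}=s^{-1/2}\prod_i \exp\big(2\pi \mathrm i\,p_iq_i/(2(m_i+J_i))\big)$, let $G=\Re F+\Im F$, and let $\Lambda$ be the diagonal matrix of the eigenvalues $\lambda=\sqrt s\,F\mathbf s$ of $S$, where $\mathbf s$ is the first row of $S$, so that $S=G\Lambda G^T$. Let $\tilde\Lambda$ arise from $\Lambda$ by replacing $k$ smallest eigenvalues by $0$. For a standard Gaussian vector $\xi$ in $\mathbb R^s$ on a probability space $(\Omega,\mathcal F,\mathbb P)$ let $\mathbf Z=(G\Lambda^{1/2}\xi)_R$ and $\tilde{\mathbf Z}=(G\tilde\Lambda^{1/2}\xi)_R$ be the unsmoothed and the smoothed sample on $\mathcal T$, where $(\cdot)_R$ keeps the entries with indices $0\le p_i\le m_i$. **Finite elements.** Take a conforming simplicial mesh of $\bar D$ whose set of vertices is $\mathcal T\cap\bar D$, and let $Z_{\mathcal T},\tilde Z_{\mathcal T}$ be the continuous functions on $\bar D$ that are affine on each simplex and interpolate $\mathbf Z$ and $\tilde{\mathbf Z}$ at the vertices. Let $\mathcal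 V_h\subset H^1_0(D)$ be the space of continuous functions that are affine on each simplex. On each element $\tau$ ($d$-dimensional simplex of the mesh) take a quadrature rule with nonnegative weights $w_{\tau,x}$ at the vertices $x$ of $\tau$, $\sum_x w_{\tau,x}=1$ (for example the trapezoidal rule). For a coefficient $\kappa$ the finite element solution is the $u\in\mathcal V_h$ with $$\sum_{\tau}\Big(\sum_{x}w_{\tau,x}\,\kappa(x)\Big)\int_\tau\nabla u\cdot\nabla v\,\mathrm dx=f(v)\qquad\text{for all }v\in\mathcal V_h .$$ Let $u_h(\omega)$ and $\tilde u_h(\omega)$ be the finite element solutions with the coefficients $\exp(Z_{\mathcal T}(\cdot,\omega))$ and $\exp(\tilde Z_{\mathcal T}(\cdot,\omega))$. **Functional.** Let $\mathcal G:H^1(D)\to\mathbb R$ be continuously Fréchet differentiable, and suppose there is $C_F$ with $C_F\in L^r(\Omega)$ for all $r\in[1,\infty)$ such that, for almost all $\omega\in\Omega$, $$\Big|\int_0^1 D_v\mathcal G\big(u_h+\theta(\tilde u_h-u_h)\big)\,\mathrm d\theta\Big|\le C_F(\omega)\,\|v\|_{H^1(D)}\qquad\text{for all }v\in H^1_0(D),$$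 where $D_v\mathcal G(\tilde v)=\lim_{\varepsilon\to0}\varepsilon^{-1}(\mathcal G(\tilde v+\varepsilon v)-\mathcal G(\tilde v))$. Put $Q_h=\mathcal G(u_h)$ and $\tilde Q_h=\mathcal G(\tilde u_h)$. **Theorem.** For all $p,q\in[1,\infty)$ both expectations below are finite and $$\mathbb E\big[|Q_h-\tilde Q_h|^p\big]\le c\;\mathbb E\big[\|Z_{\mathcal T}-\tilde Z_{\mathcal T}\|_{C^0(\bar D)}^{pq}\big]^{1/q},$$ where the constant $c$ depends only on $p$, $q$, $D$, $C$, $f$ and on upper bounds $M(r)$ for the norms $\|C_F\|_{L^r(\Omega)}$, $r\in[1,\infty)$. In particular $c$ is independent of the grid, the padding and the extension $C^{\mathrm{ext}}$, the mesh, the quadrature rule and the number $k$ of dropped eigenvalues. -/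

import Mathlib

open MeasureTheory ProbabilityTheory Set
open scoped ENNReal

noncomputable section

/-- Euclidean space `ℝᵈ`. -/
abbrev Euc (d : ℕ) : Type := EuclideanSpace ℝ (Fin d)

section Sobolev

variable {d : ℕ}

/-- Smooth test functions with compact support in `D`. -/
structure IsTest (D : Set (Euc d)) (φ : Euc d → ℝ) : Prop where
  smooth : ContDiff ℝ (⊤ : ℕ∞) φ
  compact : HasCompactSupport φ
  supp : tsupport φ ⊆ D

/-- The ambient Hilbert space `L²(D) × L²(D; ℝᵈ)` of pairs (function, vector field), with norm
`(‖u‖² + ‖g‖²)^{1/2}`. -/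
abbrev L2Pair (D : Set (Euc d)) : Type :=
  WithLp 2 (Lp ℝ 2 (volume.restrict D) × Lp (Euc d) 2 (volume.restrict D))

/-- `g` is the weak gradient of `u` on `D`. -/
def IsWeakGradient (D : Set (Euc d)) (u : Euc d → ℝ) (g : Euc d → Euc d) : Prop :=
  ∀ φ : Euc d → ℝ, IsTest D φ → ∀ v : Euc d,
    ∫ x in D, u x * fderiv ℝ φ x v = - ∫ x in D, inner ℝ (g x) v * φ x

lemma IsTest.integrable_fst {D : Set (Euc d)} {φ : Euc d → ℝ} (hφ : IsTest D φ)
    (u : Lp ℝ 2 (volume.restrict D)) (v : Euc d) :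
    Integrable (fun x => u x * fderiv ℝ φ x v) (volume.restrict D) := by
  have hc : Continuous (fun x => fderiv ℝ φ x v) :=
    (hφ.smooth.continuous_fderiv (by simp)).clm_apply continuous_const
  have hs : HasCompactSupport (fun x => fderiv ℝ φ x v) := hφ.compact.fderiv_apply (𝕜 := ℝ) v
  have h2 : MemLp (fun x => fderiv ℝ φ x v) 2 (volume.restrict D) :=
    (hc.memLp_of_hasCompactSupport hs).restrict D
  exact (Lp.memLp u).integrable_mul h2

lemma IsTest.integrable_snd {D : Set (Euc d)} {φ : Euc d → ℝ} (hφ : IsTest D φ)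
    (g : Lp (Euc d) 2 (volume.restrict D)) (v : Euc d) :
    Integrable (fun x => inner ℝ (g x) v * φ x) (volume.restrict D) := by
  have h : MemLp (fun x => inner ℝ (g x) v) 2 (volume.restrict D) :=
    (Lp.memLp g).inner_const v
  have h2 : MemLp φ 2 (volume.restrict D) :=
    (hφ.smooth.continuous.memLp_of_hasCompactSupport hφ.compact).restrict D
  exact h.integrable_mul h2

/-- The Sobolev space `H¹(D)`, realised as the space of pairs `(u, ∇u)` in `L²(D) × L²(D; ℝᵈ)`
whose second component is the weak gradient of the first. It carries the norm
`(‖u‖²_{L²} + ‖∇u‖²_{L²})^{1/2}`. -/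
def H1Submodule (D : Set (Euc d)) : Submodule ℝ (L2Pair D) where
  carrier := {p | IsWeakGradient D p.fst p.snd}
  zero_mem' := by
    intro φ _ v
    have h1 : ∫ x in D, ((0 : L2Pair D).fst : Euc d → ℝ) x * fderiv ℝ φ x v = 0 := by
      refine integral_eq_zero_of_ae ?_
      filter_upwards [Lp.coeFn_zero ℝ 2 (volume.restrict D)] with x hx
      rw [WithLp.zero_fst, hx]; simp
    have h2 : ∫ x in D, inner ℝ (((0 : L2Pair D).snd : Euc d → Euc d) x) v * φ x = 0 := by
      refine integral_eq_zero_of_ae ?_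
      filter_upwards [Lp.coeFn_zero (Euc d) 2 (volume.restrict D)] with x hx
      rw [WithLp.zero_snd, hx]; simp
    rw [h1, h2, neg_zero]
  add_mem' := by
    intro a b ha hb φ hφ v
    have h1 : ∫ x in D, ((a + b).fst : Euc d → ℝ) x * fderiv ℝ φ x v
        = ∫ x in D, ((a.fst : Euc d → ℝ) x * fderiv ℝ φ x v
          + (b.fst : Euc d → ℝ) x * fderiv ℝ φ x v) := by
      refine integral_congr_ae ?_
      filter_upwards [Lp.coeFn_add a.fst b.fst] with x hx
      rw [WithLp.add_fst, hx, Pi.add_apply, add_mul]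
    have h2 : ∫ x in D, inner ℝ (((a + b).snd : Euc d → Euc d) x) v * φ x
        = ∫ x in D, (inner ℝ ((a.snd : Euc d → Euc d) x) v * φ x
          + inner ℝ ((b.snd : Euc d → Euc d) x) v * φ x) := by
      refine integral_congr_ae ?_
      filter_upwards [Lp.coeFn_add a.snd b.snd] with x hx
      rw [WithLp.add_snd, hx, Pi.add_apply, inner_add_left, add_mul]
    rw [h1, h2, integral_add (hφ.integrable_fst _ v) (hφ.integrable_fst _ v),
      integral_add (hφ.integrable_snd _ v) (hφ.integrable_snd _ v), ha φ hφ v, hb φ hφ v]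
    ring
  smul_mem' := by
    intro c a ha φ hφ v
    have h1 : ∫ x in D, ((c • a).fst : Euc d → ℝ) x * fderiv ℝ φ x v
        = ∫ x in D, c * ((a.fst : Euc d → ℝ) x * fderiv ℝ φ x v) := by
      refine integral_congr_ae ?_
      filter_upwards [Lp.coeFn_smul c a.fst] with x hx
      rw [WithLp.smul_fst, hx, Pi.smul_apply, smul_eq_mul, mul_assoc]
    have h2 : ∫ x in D, inner ℝ (((c • a).snd : Euc d → Euc d) x) v * φ x
        = ∫ x in D, c * (inner ℝ ((a.snd : Euc d → Euc d) x) v * φ x) := by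
      refine integral_congr_ae ?_
      filter_upwards [Lp.coeFn_smul c a.snd] with x hx
      rw [WithLp.smul_snd, hx, Pi.smul_apply, real_inner_smul_left, mul_assoc]
    rw [h1, h2, integral_const_mul, integral_const_mul, ha φ hφ v]
    ring

/-- The Sobolev space `H¹(D)` as a type. -/
abbrev H1 (D : Set (Euc d)) : Type := ↥(H1Submodule D)

/-- The function underlying an element of `H¹(D)` (an `L²` representative). -/
def H1.fn {D : Set (Euc d)} (u : H1 D) : Euc d → ℝ := (u : L2Pair D).fst

/-- The weak gradient of an element of `H¹(D)` (an `L²` representative). -/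
def H1.grad {D : Set (Euc d)} (u : H1 D) : Euc d → Euc d := (u : L2Pair D).snd

/-- `H¹₀(D)`: the closure in `H¹(D)` of the smooth functions with compact support in `D`. -/
def H10 (D : Set (Euc d)) : Submodule ℝ (H1 D) :=
  (Submodule.span ℝ {u : H1 D | ∃ φ : Euc d → ℝ, IsTest D φ ∧
    u.fn =ᵐ[volume.restrict D] φ}).topologicalClosure

end Sobolev

section CirculantEmbedding

variable {d : ℕ}

/-- Index set of the (padded) embedding matrix: `2 (mᵢ + Jᵢ)` points in the `i`-th direction. -/
abbrev EmbIdx (m J : Fin d → ℕ) : Type := (i : Fin d) → Fin (2 * (m i + J i))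

/-- Index set of the uniform grid: `mᵢ + 1` points in the `i`-th direction. -/
abbrev GridIdx (m : Fin d → ℕ) : Type := (i : Fin d) → Fin (m i + 1)

/-- The grid point `(p₁ / m₁, …, p_d / m_d)` of `[0,1]ᵈ`. -/
def gridPoint (m : Fin d → ℕ) (p : GridIdx m) : Euc d :=
  WithLp.toLp 2 fun i => ((p i : ℕ) : ℝ) / (m i : ℝ)

/-- The value of the mirrored (and padded) covariance at the lag `a`: in each direction the row
`0, 1, …, m + J, m + J - 1, …, 1` of lags, in units of the mesh size `1 / m`. -/
def mirroredValue (Cext : Euc d → ℝ) (m J a : Fin d → ℕ) : ℝ :=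
  Cext (WithLp.toLp 2 fun i =>
    ((min (a i) (2 * (m i + J i) - a i) : ℕ) : ℝ) / (m i : ℝ))

/-- The embedding matrix `S`: block circulant, with entries given by the mirrored covariance values
at the lags `|pᵢ - qᵢ|`. -/
def embMatrix (Cext : Euc d → ℝ) (m J : Fin d → ℕ) : Matrix (EmbIdx m J) (EmbIdx m J) ℝ :=
  Matrix.of fun p q => mirroredValue Cext m J fun i => Nat.dist (p i) (q i)

/-- The size `s = ∏ᵢ 2 (mᵢ + Jᵢ)` of the embedding matrix. -/
def embSize (m J : Fin d → ℕ) : ℕ := ∏ i, 2 * (m i + J i)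

/-- The `d`-dimensional unitary discrete Fourier matrix `F`. -/
def dftMatrix (m J : Fin d → ℕ) : Matrix (EmbIdx m J) (EmbIdx m J) ℂ :=
  Matrix.of fun p q => ((1 / Real.sqrt (embSize m J) : ℝ) : ℂ) *
    ∏ i, Complex.exp (2 * Real.pi * Complex.I * ((p i : ℕ) : ℂ) * ((q i : ℕ) : ℂ) /
      ((2 * (m i + J i) : ℕ) : ℂ))

/-- The eigenvalues `√s F 𝐬` of `S`, where `𝐬` is the first row of `S` (these numbers are real). -/
def embEigenvalue (Cext : Euc d → ℝ) (m J : Fin d → ℕ) (p : EmbIdx m J) : ℝ :=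
  (((Real.sqrt (embSize m J) : ℝ) : ℂ) * (dftMatrix m J).mulVec
    (fun q => ((mirroredValue Cext m J fun i => (q i : ℕ) : ℝ) : ℂ)) p).re

/-- The real (Hartley) matrix `G = Re F + Im F`, for which `S = G Λ Gᵀ`. -/
def hartleyMatrix (m J : Fin d → ℕ) : Matrix (EmbIdx m J) (EmbIdx m J) ℝ :=
  Matrix.of fun p q => (dftMatrix m J p q).re + (dftMatrix m J p q).im

/-- The sample `(G Λ^{1/2} ξ)_R`, for the diagonal matrix `Λ` with diagonal `lam`: the entries of
`G Λ^{1/2} ξ` with indices `0 ≤ pᵢ ≤ mᵢ`. -/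
def embSample {m : Fin d → ℕ} (hm : ∀ i, 1 ≤ m i) (J : Fin d → ℕ) (lam : EmbIdx m J → ℝ)
    (ξ : EmbIdx m J → ℝ) (p : GridIdx m) : ℝ :=
  (hartleyMatrix m J * Matrix.diagonal fun q => Real.sqrt (lam q)).mulVec ξ
    (fun i => Fin.castLE (by have := hm i; omega) (p i))

/-- The truncated eigenvalues: those with index in `T` are replaced by zero. -/
def truncate {ι : Type*} [DecidableEq ι] (T : Finset ι) (lam : ι → ℝ) (q : ι) : ℝ :=
  if q ∈ T then 0 else lam q

/-- `T` is a set of indices of `k` smallest values of `lam`. -/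
structure IsSmallest {ι : Type*} (lam : ι → ℝ) (k : ℕ) (T : Finset ι) : Prop where
  card_eq : T.card = k
  le : ∀ p ∈ T, ∀ q ∉ T, lam p ≤ lam q

end CirculantEmbedding

section FiniteElements

variable {d : ℕ}

/-- `K` is a conforming simplicial mesh of `D` whose vertices are exactly the points of the uniform
grid lying in the closure of `D`. -/
structure IsGridMesh (D : Set (Euc d)) (m : Fin d → ℕ)
    (K : Geometry.SimplicialComplex ℝ (Euc d)) : Prop where
  space_eq : K.space = closure D
  vertices_eq : K.vertices = Set.range (gridPoint m) ∩ closure D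

/-- `g` is affine on every simplex of `K`. On the finitely many simplices of a mesh of `D` this
forces `g` to be continuous on the closure of `D`. -/
def IsPiecewiseAffine (K : Geometry.SimplicialComplex ℝ (Euc d)) (g : Euc d → ℝ) : Prop :=
  ∀ τ ∈ K.faces, ∃ A : Euc d →ᵃ[ℝ] ℝ, Set.EqOn g A (convexHull ℝ (τ : Set (Euc d)))

/-- `g` is the piecewise linear interpolant on `D` of the grid values `z`. -/
structure IsInterpolant (D : Set (Euc d)) (m : Fin d → ℕ)
    (K : Geometry.SimplicialComplex ℝ (Euc d)) (z : GridIdx m → ℝ) (g : Euc d → ℝ) : Prop where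
  affine : IsPiecewiseAffine K g
  interp : ∀ p : GridIdx m, gridPoint m p ∈ closure D → g (gridPoint m p) = z p

/-- The norm of `C⁰(D̄)`. -/
def normC0 (D : Set (Euc d)) (g : Euc d → ℝ) : ℝ := ⨆ x : closure D, |g x|

/-- The top-dimensional simplices (the elements) of the mesh. -/
def elements (K : Geometry.SimplicialComplex ℝ (Euc d)) : Set (Finset (Euc d)) :=
  {τ ∈ K.faces | τ.card = d + 1}

/-- On each element `τ`, the rule `∫_τ F ≈ |τ| ∑_{x vertex of τ} w τ x * F x` has nonnegative
weights and is exact for constants. The trapezoidal rule is `w τ x = 1 / (d + 1)`. -/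
structure IsQuadrature (K : Geometry.SimplicialComplex ℝ (Euc d))
    (w : Finset (Euc d) → Euc d → ℝ) : Prop where
  nonneg : ∀ τ ∈ elements K, ∀ x ∈ τ, 0 ≤ w τ x
  sum_eq_one : ∀ τ ∈ elements K, ∑ x ∈ τ, w τ x = 1

/-- The P1 finite element space: continuous piecewise affine functions in `H¹₀(D)`. -/
def P1Space (D : Set (Euc d)) (K : Geometry.SimplicialComplex ℝ (Euc d)) : Set (H1 D) :=
  {v | v ∈ H10 D ∧ ∃ g : Euc d → ℝ, IsPiecewiseAffine K g ∧ v.fn =ᵐ[volume.restrict D] g}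

/-- The bilinear form `∫_D k ∇u · ∇v` assembled with the quadrature rule `w`. As the gradients of P1
functions are constant on each element, applying the rule to `k ∇u · ∇v` on an element `τ` gives
`(∑ₓ w τ x * k x) * ∫_τ ∇u · ∇v`. -/
def assembledForm (D : Set (Euc d)) (K : Geometry.SimplicialComplex ℝ (Euc d))
    (w : Finset (Euc d) → Euc d → ℝ) (k : Euc d → ℝ) (u v : H1 D) : ℝ :=
  ∑ᶠ τ ∈ elements K, (∑ x ∈ τ, w τ x * k x) *
    ∫ x in convexHull ℝ (τ : Set (Euc d)) ∩ D, inner ℝ (u.grad x) (v.grad x)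

/-- `u` is the P1 finite element solution, with quadrature `w`, of `-∇·(k ∇u) = f` in `D`, `u = 0` on
the boundary, for the datum `f ∈ H⁻¹(D)`. -/
structure IsFESolution (D : Set (Euc d)) (K : Geometry.SimplicialComplex ℝ (Euc d))
    (w : Finset (Euc d) → Euc d → ℝ) (f : H10 D →L[ℝ] ℝ) (k : Euc d → ℝ) (u : H1 D) : Prop where
  mem : u ∈ P1Space D K
  eq : ∀ (v : H1 D) (hv : v ∈ P1Space D K), assembledForm D K w k u v = f ⟨v, hv.1⟩

end FiniteElements

/-- `Z` is a centred stationary Gaussian field on the closure of `D` with covariance function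
`C (x - y)` and almost surely continuous sample paths. -/
structure IsStationaryGaussianField {d : ℕ} {Ω : Type*} [MeasurableSpace Ω] (P : Measure Ω)
    (D : Set (Euc d)) (C : Euc d → ℝ) (Z : closure D → Ω → ℝ) : Prop where
  gaussian : IsGaussianProcess Z P
  mean_eq : ∀ x, ∫ ω, Z x ω ∂P = 0
  cov_eq : ∀ x y, ∫ ω, Z x ω * Z y ω ∂P = C (x - y)
  continuous : ∀ᵐ ω ∂P, Continuous fun x => Z x ω

end

/-!
The proof is pathwise up to a single probabilistic input, a bound for exponential moments of the
samples that does not see the discretisation.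

Pathwise, finite element solutions depend Lipschitz continuously on the logarithm of the
coefficient (`IsFESolution.norm_sub_le`):
`‖u_h - ũ_h‖ ≤ 5 ‖f‖ exp (2 (‖Z‖ + ‖Z̃‖)) ‖Z - Z̃‖`, with maximum norms over the vertices. This is
Galerkin orthogonality together with coercivity. The constant comes from the Poincaré inequality
`norm_le_of_mem_H10` on a strip of width one; the quadrature enters only through averages over the
vertices, so neither the mesh nor the weights matter. The maximum norm over the vertices is the
`C⁰` norm of the interpolant (`IsGridMesh.normC0_sub_eq`). As the functional is differentiable, its
difference is the integral of its derivative along the segment (`integral_lineDeriv_segment`), so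
`|Q_h - Q̃_h| ≤ |C_F| ‖u_h - ũ_h‖`.

For the exponential factor, the Hartley matrix diagonalises the embedding matrix
(`hartleyMatrix_mul_diagonal_mul_transpose`), so the unsmoothed sample has the covariance, hence the
law, of the field `Z` restricted to the vertices. Since almost every path of `Z` is bounded, one
radius works for all grids: the sample is bounded by it with probability at least `3 / 4`
(`exists_radius_sampleMap`). Fernique's theorem turns this one number into bounds for all
exponential moments (`lintegral_exp_mul_norm_le`). The smoothed sample is the average of two samples
with the law of the unsmoothed one, obtained by changing the signs of the components of `ξ` that
belong to dropped eigenvalues (`sampleMap_truncate`), and so it satisfies bounds of the same kind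
(`lintegral_exp_add_sampleMap_le`).

Finally, Hölder's inequality with exponents `4, 4, 2` separates `C_F`, the exponential and
`‖Z - Z̃‖ ^ p`. For `q < 2` the `L²` norm of the last factor may exceed its `L^q` norm, but
`Z - Z̃` is Gaussian, so its moments are equivalent with constants depending only on their orders
(`integral_norm_rpow_le_rpow_integral`). This also covers `q = 1`.
-/

/-! ### Uniform Fernique estimates and equivalence of Gaussian moments -/

/-- The exponent in Fernique's estimate for a ball of probability at least `3 / 4`. -/
noncomputable def ferniqueRate : ℝ := Fernique.logRatio (3 / 4)

/-- The right-hand side of Fernique's estimate for a ball of probability at least `3 / 4`. -/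
noncomputable def ferniqueBound : ℝ≥0∞ :=
  ENNReal.ofReal (Real.exp (Fernique.logRatio (3 / 4))) +
    ∑' n : ℕ, ENNReal.ofReal
      (Real.exp (-2⁻¹ * Real.log ((3 / 4 : ℝ≥0∞) / (1 - 3 / 4)).toReal * 2 ^ n))

lemma three_quarters_toReal : (3 / 4 : ℝ≥0∞).toReal = 3 / 4 := by
  simp [ENNReal.toReal_div]

lemma half_lt_three_quarters : (2 : ℝ≥0∞)⁻¹ < 3 / 4 := by
  rw [← ENNReal.toReal_lt_toReal (by simp) (by finiteness), three_quarters_toReal]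
  simp; norm_num

lemma three_quarters_lt_one : (3 / 4 : ℝ≥0∞) < 1 := by
  rw [← ENNReal.toReal_lt_toReal (by finiteness) (by simp), three_quarters_toReal]
  simp; norm_num

lemma ferniqueRate_pos : 0 < ferniqueRate :=
  Fernique.logRatio_pos half_lt_three_quarters three_quarters_lt_one

lemma ferniqueBound_ne_top : ferniqueBound ≠ ∞ := by
  refine (ENNReal.add_lt_top.mpr ⟨ENNReal.ofReal_lt_top, ?_⟩).ne
  refine Summable.tsum_ofReal_lt_top <|
    Real.summable_exp_nat_mul_of_ge ?_ (fun i ↦ mod_cast (Nat.lt_pow_self (by simp)).le)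
  refine mul_neg_of_neg_of_pos (by simp) (Real.log_pos ?_)
  rw [ENNReal.toReal_div, ENNReal.toReal_sub_of_le three_quarters_lt_one.le (by simp),
    three_quarters_toReal]
  norm_num

section Fernique

variable {E : Type*} [NormedAddCommGroup E] [NormedSpace ℝ E] [SecondCountableTopology E]
  [CompleteSpace E] [MeasurableSpace E] [BorelSpace E] {μ : Measure E} [IsGaussian μ]

/-- Exponential moments of a centred Gaussian measure are controlled by the radius of one ball of
probability at least `3 / 4`, uniformly over all spaces. -/
lemma lintegral_exp_mul_norm_le (hμ : ∫ x, x ∂μ = 0) {a : ℝ} (ha : 0 < a)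
    (h : 3 / 4 ≤ μ {x | ‖x‖ ≤ a}) (t : ℝ) :
    ∫⁻ x, ENNReal.ofReal (Real.exp (t * ‖x‖)) ∂μ ≤
      ENNReal.ofReal (Real.exp (t ^ 2 * a ^ 2 / (4 * ferniqueRate))) * ferniqueBound := by
  have hk := ferniqueRate_pos
  have h_rot := IsGaussian.map_rotation_eq_self (μ := μ) hμ (-(Real.pi / 4))
  have key := ProbabilityTheory.lintegral_exp_mul_sq_norm_le_of_map_rotation_eq_self h_rot h
    half_lt_three_quarters
  calc ∫⁻ x, ENNReal.ofReal (Real.exp (t * ‖x‖)) ∂μ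
      ≤ ∫⁻ x, ENNReal.ofReal (Real.exp (t ^ 2 * a ^ 2 / (4 * ferniqueRate))) *
          ENNReal.ofReal (Real.exp (Fernique.logRatio (3 / 4) * a⁻¹ ^ 2 * ‖x‖ ^ 2)) ∂μ := by
        refine lintegral_mono fun x => ?_
        rw [← ENNReal.ofReal_mul (by positivity), ← Real.exp_add]
        refine ENNReal.ofReal_le_ofReal (Real.exp_le_exp.mpr ?_)
        change _ ≤ _ + ferniqueRate * _ * _
        -- Young's inequality: the difference of both sides is a square
        have : t ^ 2 * a ^ 2 / (4 * ferniqueRate) + ferniqueRate * a⁻¹ ^ 2 * ‖x‖ ^ 2 - t * ‖x‖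
            = (t * a - 2 * ferniqueRate * a⁻¹ * ‖x‖) ^ 2 / (4 * ferniqueRate) := by
          field_simp
          ring
        have h2 : 0 ≤ (t * a - 2 * ferniqueRate * a⁻¹ * ‖x‖) ^ 2 / (4 * ferniqueRate) := by
          positivity
        linarith
    _ = ENNReal.ofReal (Real.exp (t ^ 2 * a ^ 2 / (4 * ferniqueRate))) *
          ∫⁻ x, ENNReal.ofReal (Real.exp (Fernique.logRatio (3 / 4) * a⁻¹ ^ 2 * ‖x‖ ^ 2)) ∂μ := by
        rw [lintegral_const_mul' _ _ ENNReal.ofReal_ne_top]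
    _ ≤ _ := by gcongr; exact key

lemma lintegral_norm_rpow_le (hμ : ∫ x, x ∂μ = 0) {a : ℝ} (ha : 0 < a)
    (h : 3 / 4 ≤ μ {x | ‖x‖ ≤ a}) {s : ℝ} (hs : 0 ≤ s) :
    ∫⁻ x, ENNReal.ofReal (‖x‖ ^ s) ∂μ ≤ ENNReal.ofReal (a ^ s) *
      (ENNReal.ofReal (Real.exp (s ^ 2 / (4 * ferniqueRate))) * ferniqueBound) := by
  have key := lintegral_exp_mul_norm_le hμ ha h (s / a)
  have e : (s / a) ^ 2 * a ^ 2 = s ^ 2 := by field_simp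
  rw [e] at key
  calc ∫⁻ x, ENNReal.ofReal (‖x‖ ^ s) ∂μ
      ≤ ∫⁻ x, ENNReal.ofReal (a ^ s) * ENNReal.ofReal (Real.exp (s / a * ‖x‖)) ∂μ := by
        refine lintegral_mono fun x => ?_
        rw [← ENNReal.ofReal_mul (by positivity)]
        refine ENNReal.ofReal_le_ofReal ?_
        have h1 : ‖x‖ / a ≤ Real.exp (‖x‖ / a) :=
          (by linarith [Real.add_one_le_exp (‖x‖ / a)])
        calc ‖x‖ ^ s = a ^ s * (‖x‖ / a) ^ s := by
              rw [← Real.mul_rpow ha.le (by positivity)]; congr 1; field_simp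
          _ ≤ a ^ s * (Real.exp (‖x‖ / a)) ^ s := by gcongr
          _ = a ^ s * Real.exp (s / a * ‖x‖) := by
              rw [← Real.exp_mul]; congr 2; ring
    _ = ENNReal.ofReal (a ^ s) * ∫⁻ x, ENNReal.ofReal (Real.exp (s / a * ‖x‖)) ∂μ := by
        rw [lintegral_const_mul' _ _ ENNReal.ofReal_ne_top]
    _ ≤ _ := by gcongr

lemma IsGaussian.integrable_norm_rpow (μ : Measure E) [IsGaussian μ] {r : ℝ} (hr : 0 < r) :
    Integrable (fun x => ‖x‖ ^ r) μ := by
  have := (IsGaussian.memLp_id μ (ENNReal.ofReal r) (by simp)).integrable_norm_rpow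
    (by simpa using hr) (by simp)
  simpa [ENNReal.toReal_ofReal hr.le] using this

/-- The constant in the comparison of the moment of order `s` of a Gaussian measure with lower
moments. -/
noncomputable def momentConst (s : ℝ) : ℝ :=
  4 ^ s * (Real.exp (s ^ 2 / (4 * ferniqueRate)) * ferniqueBound.toReal)

lemma momentConst_nonneg (s : ℝ) : 0 ≤ momentConst s := by
  unfold momentConst
  positivity

/-- **Kahane–Khintchine inequality** for Gaussian measures: the moment of order `s` is bounded by
the corresponding power of the moment of order `r`. By Markov's inequality the ball of radius
`4 (∫ ‖x‖ ^ r) ^ (1 / r)` has probability at least `3 / 4`, so Fernique's estimate applies. -/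
lemma integral_norm_rpow_le_rpow_integral (hμ : ∫ x, x ∂μ = 0) {r s : ℝ} (hr : 1 ≤ r) (hs : 0 < s) :
    ∫ x, ‖x‖ ^ s ∂μ ≤ momentConst s * (∫ x, ‖x‖ ^ r ∂μ) ^ (s / r) := by
  unfold momentConst
  have hr0 : 0 < r := by linarith
  have hI0 : 0 ≤ ∫ x, ‖x‖ ^ r ∂μ := integral_nonneg fun x => by positivity
  set I := ∫ x, ‖x‖ ^ r ∂μ with hI
  rcases hI0.eq_or_lt with h0 | hpos
  · have hz : ∀ᵐ x ∂μ, ‖x‖ ^ r = 0 := by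
      have := (integral_eq_zero_iff_of_nonneg (fun x => by positivity)
        (IsGaussian.integrable_norm_rpow μ hr0)).1 h0.symm
      simpa [Filter.EventuallyEq] using this
    have : ∫ x, ‖x‖ ^ s ∂μ = 0 := by
      refine integral_eq_zero_of_ae ?_
      filter_upwards [hz] with x hx
      rw [Real.rpow_eq_zero (norm_nonneg x) hr0.ne'] at hx
      simp [hx, Real.zero_rpow hs.ne']
    rw [this]
    positivity
  · set a := 4 * I ^ (1 / r) with ha
    have hapos : 0 < a := by positivity
    have har : a ^ r = 4 ^ r * I := by
      rw [ha, Real.mul_rpow (by norm_num) (by positivity), ← Real.rpow_mul hpos.le]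
      simp [hr0.ne']
    have hball : 3 / 4 ≤ μ {x | ‖x‖ ≤ a} := by
      have hm : μ.real {x | a ^ r ≤ ‖x‖ ^ r} ≤ 1 / 4 := by
        have := mul_meas_ge_le_integral_of_nonneg (μ := μ) (f := fun x => ‖x‖ ^ r)
          (Filter.Eventually.of_forall fun x => by positivity)
          (IsGaussian.integrable_norm_rpow μ hr0) (a ^ r)
        rw [har, ← hI] at this
        have h4 : (4 : ℝ) ≤ 4 ^ r := by
          simpa using Real.rpow_le_rpow_of_exponent_le (by norm_num : (1 : ℝ) ≤ 4) hr
        rw [har]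
        have h5 : 4 * I * μ.real {x | 4 ^ r * I ≤ ‖x‖ ^ r} ≤ I := by
          refine le_trans ?_ this
          gcongr
        have h6 : 4 * μ.real {x | 4 ^ r * I ≤ ‖x‖ ^ r} ≤ 1 := by
          by_contra! hc
          nlinarith
        linarith
      have hmeas : MeasurableSet {x : E | ‖x‖ ≤ a} := measurableSet_le (by fun_prop) (by fun_prop)
      have hc : μ.real {x | ‖x‖ ≤ a}ᶜ ≤ 1 / 4 := by
        refine le_trans (measureReal_mono ?_) hm
        intro x hx
        simp only [mem_compl_iff, mem_ofPred_eq, not_le] at hx ⊢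
        exact Real.rpow_le_rpow hapos.le hx.le hr0.le
      rw [probReal_compl_eq_one_sub hmeas] at hc
      rw [← ENNReal.toReal_le_toReal (by finiteness) (by finiteness), three_quarters_toReal]
      change _ ≤ μ.real _
      linarith
    have key := lintegral_norm_rpow_le hμ hapos hball hs.le
    rw [integral_eq_lintegral_of_nonneg_ae (Filter.Eventually.of_forall fun x => by positivity)
      (IsGaussian.integrable_norm_rpow μ hs).aestronglyMeasurable]
    refine (ENNReal.toReal_mono ?_ key).trans_eq ?_
    · exact ENNReal.mul_ne_top (by simp) (ENNReal.mul_ne_top (by simp) ferniqueBound_ne_top)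
    · rw [ENNReal.toReal_mul, ENNReal.toReal_mul, ENNReal.toReal_ofReal (by positivity),
        ENNReal.toReal_ofReal (by positivity), ha, Real.mul_rpow (by norm_num) (by positivity),
        ← Real.rpow_mul hpos.le, one_div_mul_eq_div]
      ring

/-- The `L²` norm of `‖x‖ ^ p` is controlled by its `L^q` norm, also for `q = 1`. -/
lemma lintegral_norm_rpow_sq_le (hμ : ∫ x, x ∂μ = 0) {p q : ℝ} (hp : 1 ≤ p) (hq : 1 ≤ q) :
    (∫⁻ x, ENNReal.ofReal (‖x‖ ^ p) ^ (2 : ℝ) ∂μ) ^ (1 / 2 : ℝ) ≤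
      ENNReal.ofReal (momentConst (2 * p)) ^ (1 / 2 : ℝ) *
        ENNReal.ofReal ((∫ x, ‖x‖ ^ (p * q) ∂μ) ^ (1 / q)) := by
  have hp0 : 0 < p := by linarith
  have hq0 : 0 < q := by linarith
  have h1 := integral_norm_rpow_le_rpow_integral hμ (r := p * q) (s := 2 * p)
    (one_le_mul_of_one_le_of_one_le hp hq) (by positivity)
  have hI : 0 ≤ ∫ x, ‖x‖ ^ (p * q) ∂μ := integral_nonneg fun x => by positivity
  have h2 : ∫⁻ x, ENNReal.ofReal (‖x‖ ^ p) ^ (2 : ℝ) ∂μ =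
      ENNReal.ofReal (∫ x, ‖x‖ ^ (2 * p) ∂μ) := by
    rw [ofReal_integral_eq_lintegral_ofReal
      (IsGaussian.integrable_norm_rpow μ (by positivity))
      (Filter.Eventually.of_forall fun x => by positivity)]
    refine lintegral_congr fun x => ?_
    rw [ENNReal.ofReal_rpow_of_nonneg (by positivity) (by norm_num),
      ← Real.rpow_mul (norm_nonneg x), mul_comm]
  have h3 : (∫ x, ‖x‖ ^ (p * q) ∂μ) ^ (1 / q) =
      ((∫ x, ‖x‖ ^ (p * q) ∂μ) ^ (2 * p / (p * q))) ^ (1 / 2 : ℝ) := by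
    rw [← Real.rpow_mul hI]
    congr 1
    field_simp
  rw [h2, h3, ← ENNReal.ofReal_rpow_of_nonneg (by positivity) (by norm_num),
    ← ENNReal.mul_rpow_of_nonneg _ _ (by norm_num),
    ← ENNReal.ofReal_mul (momentConst_nonneg _)]
  exact ENNReal.rpow_le_rpow (ENNReal.ofReal_le_ofReal h1) (by norm_num)

end Fernique

/-! ### Diagonalisation of the embedding matrix by the Hartley matrix -/

section Dft

variable {ι : Type*} [Fintype ι]

/-- The character `k ↦ exp (2 π i ∑ aᵢ kᵢ / nᵢ)` of `∏ ℤ / nᵢ`, with integer representatives. -/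
noncomputable def gridChar (n : ι → ℕ) (a k : ι → ℤ) : ℂ :=
  ∏ i, Complex.exp (2 * Real.pi * Complex.I * (a i : ℂ) * (k i : ℂ) / ((n i : ℕ) : ℂ))

lemma gridChar_comm (n : ι → ℕ) (a k : ι → ℤ) : gridChar n a k = gridChar n k a := by
  unfold gridChar
  refine Finset.prod_congr rfl fun i _ => ?_
  congr 1; ring

lemma gridChar_add (n : ι → ℕ) (a b k : ι → ℤ) :
    gridChar n (a + b) k = gridChar n a k * gridChar n b k := by
  unfold gridChar
  rw [← Finset.prod_mul_distrib]
  refine Finset.prod_congr rfl fun i _ => ?_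
  rw [← Complex.exp_add]
  congr 1
  simp only [Pi.add_apply]; push_cast; ring

lemma gridChar_neg (n : ι → ℕ) (a k : ι → ℤ) :
    gridChar n (-a) k = (starRingEnd ℂ) (gridChar n a k) := by
  unfold gridChar
  rw [map_prod]
  refine Finset.prod_congr rfl fun i _ => ?_
  rw [← Complex.exp_conj]
  congr 1
  simp only [Pi.neg_apply, map_div₀, map_mul, Complex.conj_I, Complex.conj_ofReal, map_intCast,
    map_natCast, map_ofNat]
  push_cast; ring

lemma sum_exp_two_pi (n : ℕ) [NeZero n] (a : ℤ) :
    ∑ k : Fin n, Complex.exp (2 * Real.pi * Complex.I * (a : ℂ) * (((k : ℕ) : ℤ) : ℂ) / (n : ℂ)) =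
      if (n : ℤ) ∣ a then (n : ℂ) else 0 := by
  have hn : (n : ℂ) ≠ 0 := by exact_mod_cast NeZero.ne n
  have hpi : (2 * Real.pi * Complex.I : ℂ) ≠ 0 := Complex.two_pi_I_ne_zero
  set ζ := Complex.exp (2 * Real.pi * Complex.I * (a : ℂ) / (n : ℂ)) with hζ
  have h1 : ∀ k : Fin n,
      Complex.exp (2 * Real.pi * Complex.I * (a : ℂ) * (((k : ℕ) : ℤ) : ℂ) / (n : ℂ)) =
        ζ ^ (k : ℕ) := by
    intro k
    rw [hζ, ← Complex.exp_nat_mul]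
    congr 1; push_cast; ring
  simp_rw [h1]
  rw [Fin.sum_univ_eq_sum_range (fun k => ζ ^ k) n]
  have hz : ζ = 1 ↔ (n : ℤ) ∣ a := by
    rw [hζ, Complex.exp_eq_one_iff]
    constructor
    · rintro ⟨l, hl⟩
      refine ⟨l, ?_⟩
      have : (a : ℂ) = n * l := by
        field_simp at hl
        exact hl
      exact_mod_cast this
    · rintro ⟨l, rfl⟩
      refine ⟨l, ?_⟩
      push_cast
      field_simp
  split_ifs with h
  · simp [hz.2 h]
  · have hne : ζ ≠ 1 := fun h' => h (hz.1 h')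
    have hpow : ζ ^ n = 1 := by
      rw [hζ, ← Complex.exp_nat_mul, Complex.exp_eq_one_iff]
      exact ⟨a, by field_simp⟩
    rw [geom_sum_eq hne, hpow, sub_self, zero_div]

/-- Integer representatives of an element of `∏ Fin nᵢ`. -/
def intRep {n : ι → ℕ} (p : (i : ι) → Fin (n i)) : ι → ℤ := fun i => ((p i : ℕ) : ℤ)

/-- Orthogonality of characters. -/
lemma sum_gridChar (n : ι → ℕ) [∀ i, NeZero (n i)] [DecidableEq ι] (a : ι → ℤ) :
    ∑ k : (i : ι) → Fin (n i), gridChar n a (intRep k) =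
      if ∀ i, (n i : ℤ) ∣ a i then ((∏ i, n i : ℕ) : ℂ) else 0 := by
  unfold gridChar intRep
  have h0 := Finset.prod_univ_sum (fun i => (Finset.univ : Finset (Fin (n i)))) (fun i k =>
    Complex.exp (2 * Real.pi * Complex.I * (a i : ℂ) * (((k : ℕ) : ℤ) : ℂ) / ((n i : ℕ) : ℂ)))
  rw [Fintype.piFinset_univ] at h0
  rw [← h0]
  simp_rw [sum_exp_two_pi]
  split_ifs with h
  · push_cast
    exact Finset.prod_congr rfl fun i _ => if_pos (h i)
  · push Not at h
    obtain ⟨i, hi⟩ := h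
    exact Finset.prod_eq_zero (Finset.mem_univ i) (if_neg hi)

end Dft

section Embedding

variable {d : ℕ}

lemma embSize_pos {m : Fin d → ℕ} (hm : ∀ i, 1 ≤ m i) (J : Fin d → ℕ) : 0 < embSize m J :=
  Finset.prod_pos fun i _ => by have := hm i; omega

lemma dftMatrix_apply (m J : Fin d → ℕ) (p q : EmbIdx m J) :
    dftMatrix m J p q = ((1 / Real.sqrt (embSize m J) : ℝ) : ℂ) *
      gridChar (fun i => 2 * (m i + J i)) (intRep p) (intRep q) := by
  simp only [dftMatrix, Matrix.of_apply, gridChar, intRep, Int.cast_natCast]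

lemma hartleyMatrix_apply (m J : Fin d → ℕ) (p q : EmbIdx m J) :
    hartleyMatrix m J p q = 1 / Real.sqrt (embSize m J) *
      ((gridChar (fun i => 2 * (m i + J i)) (intRep p) (intRep q)).re +
        (gridChar (fun i => 2 * (m i + J i)) (intRep p) (intRep q)).im) := by
  simp only [hartleyMatrix, Matrix.of_apply, dftMatrix_apply, Complex.re_ofReal_mul,
    Complex.im_ofReal_mul]
  ring

lemma embEigenvalue_eq {m : Fin d → ℕ} (hm : ∀ i, 1 ≤ m i) (Cext : Euc d → ℝ) (J : Fin d → ℕ)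
    (k : EmbIdx m J) :
    embEigenvalue Cext m J k = ∑ j : EmbIdx m J, mirroredValue Cext m J (fun i => (j i : ℕ)) *
      (gridChar (fun i => 2 * (m i + J i)) (intRep j) (intRep k)).re := by
  have hs : (0 : ℝ) < Real.sqrt (embSize m J) :=
    Real.sqrt_pos.2 (by exact_mod_cast embSize_pos hm J)
  simp only [embEigenvalue, Matrix.mulVec, dotProduct, Finset.mul_sum, Complex.re_sum,
    dftMatrix_apply]
  refine Finset.sum_congr rfl fun j _ => ?_
  rw [gridChar_comm]
  rw [show ((Real.sqrt (embSize m J) : ℝ) : ℂ) * (((1 / Real.sqrt (embSize m J) : ℝ) : ℂ) *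
      gridChar (fun i => 2 * (m i + J i)) (intRep j) (intRep k) *
        ((mirroredValue Cext m J fun i => (j i : ℕ) : ℝ) : ℂ)) =
      ((mirroredValue Cext m J fun i => (j i : ℕ) : ℝ) : ℂ) *
        gridChar (fun i => 2 * (m i + J i)) (intRep j) (intRep k) by
    have : ((Real.sqrt (embSize m J) : ℝ) : ℂ) ≠ 0 := by exact_mod_cast hs.ne'
    push_cast
    field_simp]
  rw [Complex.re_ofReal_mul]

/-- Product-to-sum formula for `cas θ = cos θ + sin θ`. -/
lemma gridChar_cas_mul {ι : Type*} [Fintype ι] (n : ι → ℕ) (a b k : ι → ℤ) :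
    ((gridChar n a k).re + (gridChar n a k).im) * ((gridChar n b k).re + (gridChar n b k).im) =
      (gridChar n (a - b) k).re + (gridChar n (a + b) k).im := by
  rw [sub_eq_add_neg, gridChar_add, gridChar_neg, gridChar_add]
  simp only [Complex.mul_re, Complex.mul_im, Complex.conj_re, Complex.conj_im]
  ring

lemma gridChar_re_mul {ι : Type*} [Fintype ι] (n : ι → ℕ) (j a b k : ι → ℤ) :
    (gridChar n j k).re * ((gridChar n a k).re + (gridChar n b k).im) =
      2⁻¹ * ((gridChar n (j + a) k).re + (gridChar n (j - a) k).re +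
        (gridChar n (j + b) k).im + (gridChar n (b - j) k).im) := by
  rw [sub_eq_add_neg, sub_eq_add_neg, gridChar_add, gridChar_add, gridChar_add, gridChar_add,
    gridChar_neg, gridChar_neg]
  simp only [Complex.mul_re, Complex.mul_im, Complex.conj_re, Complex.conj_im]
  ring

lemma sum_gridChar_re {ι : Type*} [Fintype ι] [DecidableEq ι] (n : ι → ℕ) [∀ i, NeZero (n i)]
    (a : ι → ℤ) : ∑ k : (i : ι) → Fin (n i), (gridChar n a (intRep k)).re =
      if ∀ i, (n i : ℤ) ∣ a i then ((∏ i, n i : ℕ) : ℝ) else 0 := by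
  rw [← Complex.re_sum, sum_gridChar]
  split_ifs
  · exact Complex.natCast_re _
  · rfl

lemma sum_gridChar_im {ι : Type*} [Fintype ι] [DecidableEq ι] (n : ι → ℕ) [∀ i, NeZero (n i)]
    (a : ι → ℤ) : ∑ k : (i : ι) → Fin (n i), (gridChar n a (intRep k)).im = 0 := by
  rw [← Complex.im_sum, sum_gridChar]
  split_ifs
  · exact Complex.natCast_im _
  · rfl

lemma hartleyMatrix_mul_transpose {m : Fin d → ℕ} (hm : ∀ i, 1 ≤ m i) (J : Fin d → ℕ) :
    hartleyMatrix m J * (hartleyMatrix m J).transpose = 1 := by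
  have hn : ∀ i, NeZero (2 * (m i + J i)) := fun i => ⟨by have := hm i; omega⟩
  have hs0 : (0 : ℝ) < embSize m J := by exact_mod_cast embSize_pos hm J
  ext p q
  rw [Matrix.mul_apply]
  simp only [Matrix.transpose_apply, hartleyMatrix_apply]
  have : ∀ k : EmbIdx m J, 1 / Real.sqrt (embSize m J) *
      ((gridChar (fun i => 2 * (m i + J i)) (intRep p) (intRep k)).re +
        (gridChar (fun i => 2 * (m i + J i)) (intRep p) (intRep k)).im) *
      (1 / Real.sqrt (embSize m J) *
      ((gridChar (fun i => 2 * (m i + J i)) (intRep q) (intRep k)).re +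
        (gridChar (fun i => 2 * (m i + J i)) (intRep q) (intRep k)).im)) =
      (1 / embSize m J : ℝ) *
        ((gridChar (fun i => 2 * (m i + J i)) (intRep p - intRep q) (intRep k)).re +
        (gridChar (fun i => 2 * (m i + J i)) (intRep p + intRep q) (intRep k)).im) := by
    intro k
    rw [← gridChar_cas_mul, mul_mul_mul_comm, div_mul_div_comm, Real.mul_self_sqrt hs0.le, one_mul]
  simp_rw [this]
  rw [← Finset.mul_sum, Finset.sum_add_distrib, sum_gridChar_re, sum_gridChar_im, add_zero]
  have hiff : (∀ i, ((2 * (m i + J i) : ℕ) : ℤ) ∣ (intRep p - intRep q) i) ↔ p = q := by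
    constructor
    · intro h
      funext i
      have h1 := Int.eq_zero_of_abs_lt_dvd (h i) (by
        have h2 := (p i).isLt
        have h3 := (q i).isLt
        simp only [Pi.sub_apply, intRep]
        rw [abs_lt]; omega)
      simp only [Pi.sub_apply, intRep] at h1
      exact Fin.ext (by omega)
    · rintro rfl i
      simp
  rw [Matrix.one_apply]
  simp only [hiff]
  split_ifs
  · have : ((∏ i, 2 * (m i + J i) : ℕ) : ℝ) = embSize m J := rfl
    rw [this]; field_simp
  · simp

/-- The element of `∏ Fin nᵢ` congruent to a given integer vector. -/
def modRep (n : Fin d → ℕ) [∀ i, NeZero (n i)] (a : Fin d → ℤ) : (i : Fin d) → Fin (n i) :=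
  fun i => ⟨(a i % (n i : ℤ)).toNat, by
    have h0 : (n i : ℤ) ≠ 0 := by exact_mod_cast NeZero.ne (n i)
    have h1 := Int.emod_nonneg (a i) h0
    have h2 := Int.emod_lt_of_pos (a i) (by have := NeZero.pos (n i); omega : (0 : ℤ) < n i)
    omega⟩

lemma dvd_intRep_sub_iff (n : Fin d → ℕ) [∀ i, NeZero (n i)] (a : Fin d → ℤ)
    (j : (i : Fin d) → Fin (n i)) :
    (∀ i, (n i : ℤ) ∣ (intRep j - a) i) ↔ j = modRep n a := by
  rw [funext_iff]
  refine forall_congr' fun i => ?_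
  have h0 : (n i : ℤ) ≠ 0 := by exact_mod_cast NeZero.ne (n i)
  have h1 := Int.emod_nonneg (a i) h0
  have h3 : ((j i : ℕ) : ℤ) % (n i : ℤ) = (j i : ℕ) :=
    Int.emod_eq_of_lt (by omega) (by have := (j i).isLt; omega)
  simp only [Pi.sub_apply, intRep, modRep, Fin.ext_iff]
  rw [← Int.modEq_iff_dvd, Int.ModEq, h3]
  omega

/-- Folding a lag by `a ↦ min a (n - a)` turns the residue of a difference into the one of its
absolute value. -/
lemma min_emod_sub (n p q : ℕ) (hp : p < n) (hq : q < n) :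
    min (((p : ℤ) - q) % (n : ℤ)).toNat (n - (((p : ℤ) - q) % (n : ℤ)).toNat) =
      min (Nat.dist p q) (n - Nat.dist p q) := by
  rcases le_or_gt q p with h | h
  · rw [Int.emod_eq_of_lt (by omega) (by omega), Nat.dist_eq_sub_of_le_right h]
    congr 1 <;> omega
  · rw [← Int.add_emod_right, Int.emod_eq_of_lt (by omega) (by omega),
      Nat.dist_eq_sub_of_le h.le]
    omega

lemma mirroredValue_modRep {m : Fin d → ℕ} (J : Fin d → ℕ)
    [∀ i, NeZero (2 * (m i + J i))] (Cext : Euc d → ℝ) (p q : EmbIdx m J) :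
    mirroredValue Cext m J
      (fun i => (modRep (fun i => 2 * (m i + J i)) (intRep p - intRep q) i : ℕ)) =
      embMatrix Cext m J p q := by
  simp only [mirroredValue, embMatrix, Matrix.of_apply]
  congr 2
  funext i
  congr 2
  exact min_emod_sub _ _ _ (p i).isLt (q i).isLt

/-- The Hartley matrix diagonalises the embedding matrix: `G Λ Gᵀ = S`. -/
lemma hartleyMatrix_mul_diagonal_mul_transpose {m : Fin d → ℕ} (hm : ∀ i, 1 ≤ m i)
    (J : Fin d → ℕ) (Cext : Euc d → ℝ) :
    hartleyMatrix m J * Matrix.diagonal (embEigenvalue Cext m J) * (hartleyMatrix m J).transpose =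
      embMatrix Cext m J := by
  have hn : ∀ i, NeZero (2 * (m i + J i)) := fun i => ⟨by have := hm i; omega⟩
  have hs0 : (0 : ℝ) < embSize m J := by exact_mod_cast embSize_pos hm J
  ext p q
  rw [Matrix.mul_apply]
  simp only [Matrix.mul_diagonal, Matrix.transpose_apply, hartleyMatrix_apply]
  set n : Fin d → ℕ := fun i => 2 * (m i + J i) with hndef
  set σ : EmbIdx m J → ℝ := fun j => mirroredValue Cext m J (fun i => (j i : ℕ)) with hσ
  have h1 : ∀ k : EmbIdx m J, 1 / Real.sqrt (embSize m J) *
      ((gridChar n (intRep p) (intRep k)).re + (gridChar n (intRep p) (intRep k)).im) *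
      embEigenvalue Cext m J k * (1 / Real.sqrt (embSize m J) *
      ((gridChar n (intRep q) (intRep k)).re + (gridChar n (intRep q) (intRep k)).im)) =
      ∑ j : EmbIdx m J, σ j * ((1 / embSize m J : ℝ) * (2⁻¹ *
        ((gridChar n (intRep j - (intRep q - intRep p)) (intRep k)).re +
         (gridChar n (intRep j - (intRep p - intRep q)) (intRep k)).re +
         (gridChar n (intRep j + (intRep p + intRep q)) (intRep k)).im +
         (gridChar n (intRep p + intRep q - intRep j) (intRep k)).im))) := by
    intro k
    have hj : ∀ j : EmbIdx m J, intRep j - (intRep q - intRep p) =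
        intRep j + (intRep p - intRep q) := fun j => by abel
    simp_rw [hj, ← gridChar_re_mul, ← gridChar_cas_mul]
    rw [embEigenvalue_eq hm, Finset.mul_sum, Finset.sum_mul]
    refine Finset.sum_congr rfl fun j _ => ?_
    have : (1 / embSize m J : ℝ) = 1 / Real.sqrt (embSize m J) * (1 / Real.sqrt (embSize m J)) := by
      rw [div_mul_div_comm, Real.mul_self_sqrt hs0.le, one_mul]
    rw [this, hσ]
    ring
  have hre : ∀ c : Fin d → ℤ, ∑ k : EmbIdx m J, (gridChar n c (intRep k)).re =
      if ∀ i, (n i : ℤ) ∣ c i then (embSize m J : ℝ) else 0 := fun c => by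
    have h := sum_gridChar_re n c
    rw [show ((∏ i, n i : ℕ) : ℝ) = embSize m J from rfl] at h
    convert! h
  have him : ∀ c : Fin d → ℤ, ∑ k : EmbIdx m J, (gridChar n c (intRep k)).im = 0 :=
    fun c => sum_gridChar_im n c
  have hdvd : ∀ (a : Fin d → ℤ) (j : EmbIdx m J),
      (∀ i, (n i : ℤ) ∣ (intRep j - a) i) ↔ j = modRep n a := fun a j => dvd_intRep_sub_iff n a j
  rw [Finset.sum_congr rfl fun k _ => h1 k, Finset.sum_comm]
  -- by orthogonality the sine terms vanish, and each cosine term selects a single `j`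
  simp_rw [← Finset.mul_sum, Finset.sum_add_distrib, him, hre, hdvd, add_zero, mul_add,
    Finset.sum_add_distrib]
  simp only [mul_ite, mul_zero, Finset.sum_ite_eq', Finset.mem_univ, if_true]
  have e1 : σ (modRep n (intRep q - intRep p)) = embMatrix Cext m J q p :=
    mirroredValue_modRep J Cext q p
  have e2 : σ (modRep n (intRep p - intRep q)) = embMatrix Cext m J p q :=
    mirroredValue_modRep J Cext p q
  have e3 : embMatrix Cext m J q p = embMatrix Cext m J p q := by
    change mirroredValue Cext m J _ = mirroredValue Cext m J _
    congr 1
    funext i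
    exact Nat.dist_comm _ _
  rw [e1, e2, e3]
  field_simp
  ring

lemma embEigenvalue_nonneg {m : Fin d → ℕ} (hm : ∀ i, 1 ≤ m i) (J : Fin d → ℕ)
    (Cext : Euc d → ℝ) (hS : (embMatrix Cext m J).PosSemidef) (k : EmbIdx m J) :
    0 ≤ embEigenvalue Cext m J k := by
  have h1 := hartleyMatrix_mul_transpose hm J
  have h2 : (hartleyMatrix m J).transpose * hartleyMatrix m J = 1 := mul_eq_one_comm.mp h1
  have h3 : (hartleyMatrix m J).conjTranspose * embMatrix Cext m J * hartleyMatrix m J =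
      Matrix.diagonal (embEigenvalue Cext m J) := by
    rw [← hartleyMatrix_mul_diagonal_mul_transpose hm J Cext,
      Matrix.conjTranspose_eq_transpose_of_trivial]
    simp only [← Matrix.mul_assoc]
    rw [h2, Matrix.one_mul, Matrix.mul_assoc, h2, Matrix.mul_one]
  have h4 := (hS.conjTranspose_mul_mul_same (hartleyMatrix m J)).diag_nonneg (i := k)
  rwa [h3, Matrix.diagonal_apply_eq] at h4

end Embedding

/-! ### Gaussian measures on finite products of the line -/

section GaussianPi

variable {V : Type*} [Fintype V]

lemma integrable_eval_mul_eval (μ : Measure (V → ℝ)) [IsGaussian μ] (i j : V) :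
    Integrable (fun x => x i * x j) μ := by
  have h := IsGaussian.memLp_two_id (μ := μ)
  have hi : ∀ i : V, MemLp (fun x : V → ℝ => x i) 2 μ := fun i =>
    h.of_le (measurable_pi_apply i).aestronglyMeasurable
      (Filter.Eventually.of_forall fun x => norm_le_pi_norm x i)
  exact (hi i).integrable_mul (hi j)

/-- A centred Gaussian measure on `V → ℝ` is determined by its covariances. -/
lemma IsGaussian.ext_of_integral_mul {μ ν : Measure (V → ℝ)} [IsGaussian μ] [IsGaussian ν]
    (hμ : ∫ x, x ∂μ = 0) (hν : ∫ x, x ∂ν = 0)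
    (h : ∀ i j, ∫ x, x i * x j ∂μ = ∫ x, x i * x j ∂ν) : μ = ν := by
  classical
  have key : ∀ (ρ : Measure (V → ℝ)) [IsGaussian ρ], ∫ x, x ∂ρ = 0 →
      ∀ L : StrongDual ℝ (V → ℝ), Var[L; ρ] =
        ∑ i, ∑ j, L (Pi.single i 1) * L (Pi.single j 1) * ∫ x, x i * x j ∂ρ := by
    intro ρ _ hρ L
    have h0 : ∫ x, L x ∂ρ = 0 := by rw [IsGaussian.integral_dual, hρ, map_zero]
    rw [variance_of_integral_eq_zero (by fun_prop) h0]
    have hL : ∀ x : V → ℝ, L x ^ 2 =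
        ∑ i, ∑ j, L (Pi.single i 1) * L (Pi.single j 1) * (x i * x j) := by
      intro x
      have : L x = ∑ i, L (Pi.single i 1) * x i := by
        conv_lhs => rw [pi_eq_sum_univ' x, map_sum]
        refine Finset.sum_congr rfl fun i _ => ?_
        rw [map_smul, smul_eq_mul, mul_comm]
      rw [this, sq, Finset.sum_mul_sum]
      refine Finset.sum_congr rfl fun i _ => Finset.sum_congr rfl fun j _ => by ring
    simp_rw [hL]
    rw [integral_finsetSum _ fun i _ => integrable_finsetSum _ fun j _ =>
      (integrable_eval_mul_eval ρ i j).const_mul _]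
    refine Finset.sum_congr rfl fun i _ => ?_
    rw [integral_finsetSum _ fun j _ => (integrable_eval_mul_eval ρ i j).const_mul _]
    refine Finset.sum_congr rfl fun j _ => ?_
    rw [integral_const_mul]
  refine Measure.ext_of_charFunDual ?_
  ext L
  rw [IsGaussian.charFunDual_eq_of_integral_eq_zero hμ,
    IsGaussian.charFunDual_eq_of_integral_eq_zero hν, key μ hμ, key ν hν]
  simp_rw [h]

/-- The law of a standard Gaussian vector. -/
noncomputable abbrev stdGaussianPi (V : Type*) [Fintype V] : Measure (V → ℝ) :=
  Measure.pi fun _ => gaussianReal 0 1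

instance isGaussian_stdGaussianPi : IsGaussian (stdGaussianPi V) := by
  have h : HasGaussianLaw (fun (x : V → ℝ) => (fun i => x i)) (stdGaussianPi V) := by
    refine iIndepFun.hasGaussianLaw (X := fun i (x : V → ℝ) => x i) (fun i => ?_) ?_
    · have := (measurePreserving_eval (fun _ : V => gaussianReal 0 1) i).hasLaw
      exact this.hasGaussianLaw
    · exact iIndepFun_pi (X := fun _ x => x) (fun _ => aemeasurable_id)
  have := h.isGaussian_map
  simpa using this

lemma integral_stdGaussianPi : ∫ x, x ∂(stdGaussianPi V) = 0 := by
  ext i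
  have h1 := eval_integral (μ := stdGaussianPi V) (f := fun x => x) (i := i) fun j =>
    (IsGaussian.integrable_id (μ := stdGaussianPi V)).eval j
  rw [h1]
  have := integral_comp_eval (μ := fun _ : V => gaussianReal 0 1) (i := i) (f := fun x => x)
    (by fun_prop)
  rw [this, integral_id_gaussianReal]
  rfl

lemma integral_mul_stdGaussianPi [DecidableEq V] (i j : V) :
    ∫ x, x i * x j ∂(stdGaussianPi V) = if i = j then 1 else 0 := by
  have hz : ∀ i : V, ∫ x, x i ∂(stdGaussianPi V) = 0 := by
    intro i
    have := integral_comp_eval (μ := fun _ : V => gaussianReal 0 1) (i := i) (f := fun x => x)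
      (by fun_prop)
    rw [this, integral_id_gaussianReal]
  split_ifs with hij
  · subst hij
    have := integral_comp_eval (μ := fun _ : V => gaussianReal 0 1) (i := i)
      (f := fun x => x * x) (by fun_prop)
    rw [this]
    have hv := variance_fun_id_gaussianReal (μ := 0) (v := 1)
    rw [variance_of_integral_eq_zero (by fun_prop) integral_id_gaussianReal] at hv
    simpa [sq] using hv
  · have hind := (iIndepFun_pi (μ := fun _ : V => gaussianReal 0 1) (X := fun _ x => x)
      (fun _ => aemeasurable_id)).indepFun hij
    have := hind.integral_fun_mul_eq_mul_integral
      (measurable_pi_apply i).aestronglyMeasurable (measurable_pi_apply j).aestronglyMeasurable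
    rw [this, hz i, zero_mul]

end GaussianPi

/-! ### The law of the samples -/

section Samples

variable {d : ℕ}

/-- The indices of the grid points in the closure of `D`, i.e. of the vertices of the mesh. -/
abbrev VertIdx (D : Set (Euc d)) (m : Fin d → ℕ) : Type :=
  {p : GridIdx m // gridPoint m p ∈ closure D}

noncomputable instance (D : Set (Euc d)) (m : Fin d → ℕ) : Fintype (VertIdx D m) := by
  classical
  exact inferInstanceAs (Fintype {p : GridIdx m // gridPoint m p ∈ closure D})

/-- The position in the embedding of a grid index. -/
def toEmbIdx {m : Fin d → ℕ} (hm : ∀ i, 1 ≤ m i) (J : Fin d → ℕ) (p : GridIdx m) : EmbIdx m J :=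
  fun i => Fin.castLE (by have := hm i; omega) (p i)

/-- The linear map taking `ξ` to the values of the sample `G Λ^{1/2} ξ` at the vertices. -/
noncomputable def sampleMap (D : Set (Euc d)) {m : Fin d → ℕ} (hm : ∀ i, 1 ≤ m i) (J : Fin d → ℕ)
    (lam : EmbIdx m J → ℝ) : (EmbIdx m J → ℝ) →L[ℝ] (VertIdx D m → ℝ) :=
  LinearMap.toContinuousLinearMap
    ((LinearMap.funLeft ℝ ℝ fun v : VertIdx D m => toEmbIdx hm J v.1) ∘ₗ
      (hartleyMatrix m J * Matrix.diagonal fun q => Real.sqrt (lam q)).mulVecLin)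

lemma sampleMap_apply_eq_sum (D : Set (Euc d)) {m : Fin d → ℕ} (hm : ∀ i, 1 ≤ m i) (J : Fin d → ℕ)
    (lam : EmbIdx m J → ℝ) (ξ : EmbIdx m J → ℝ) (v : VertIdx D m) :
    sampleMap D hm J lam ξ v =
      ∑ k, hartleyMatrix m J (toEmbIdx hm J v.1) k * Real.sqrt (lam k) * ξ k := by
  change ∑ k, (hartleyMatrix m J * Matrix.diagonal fun q => Real.sqrt (lam q)) _ k * ξ k = _
  simp only [Matrix.mul_diagonal]

lemma integral_map_sampleMap (D : Set (Euc d)) {m : Fin d → ℕ} {J : Fin d → ℕ}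
    (A : (EmbIdx m J → ℝ) →L[ℝ] (VertIdx D m → ℝ)) :
    ∫ x, x ∂((stdGaussianPi (EmbIdx m J)).map A) = 0 := by
  rw [integral_map (by fun_prop) (by fun_prop),
    A.integral_comp_comm (φ := fun x => x) IsGaussian.integrable_id, integral_stdGaussianPi,
    map_zero]

/-- The covariance of the (unsmoothed) sample is the original covariance function. -/
lemma integral_sampleMap_mul (D : Set (Euc d)) (C : Euc d → ℝ)
    (hC : ∀ t : Euc d, C (WithLp.toLp 2 fun i => |t i|) = C t)
    {m : Fin d → ℕ} (hm : ∀ i, 1 ≤ m i) (J : Fin d → ℕ)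
    (Cext : Euc d → ℝ) (hCext : ∀ t : Euc d, (∀ i, t i ∈ Set.Icc (0 : ℝ) 1) → Cext t = C t)
    (hS : (embMatrix Cext m J).PosSemidef) (v w : VertIdx D m) :
    ∫ x, x v * x w ∂((stdGaussianPi (EmbIdx m J)).map
      (sampleMap D hm J (embEigenvalue Cext m J))) = C (gridPoint m v.1 - gridPoint m w.1) := by
  rw [integral_map (by fun_prop) (by
    exact ((measurable_pi_apply v).mul (measurable_pi_apply w)).aestronglyMeasurable)]
  set lam := embEigenvalue Cext m J
  set P := toEmbIdx hm J v.1
  set Q := toEmbIdx hm J w.1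
  have h1 : ∀ ξ : EmbIdx m J → ℝ, sampleMap D hm J lam ξ v * sampleMap D hm J lam ξ w =
      ∑ k, ∑ l, (hartleyMatrix m J P k * Real.sqrt (lam k) *
        (hartleyMatrix m J Q l * Real.sqrt (lam l))) * (ξ k * ξ l) := by
    intro ξ
    rw [sampleMap_apply_eq_sum, sampleMap_apply_eq_sum, Finset.sum_mul_sum]
    refine Finset.sum_congr rfl fun k _ => Finset.sum_congr rfl fun l _ => by ring
  simp_rw [h1]
  rw [integral_finsetSum _ fun k _ => integrable_finsetSum _ fun l _ =>
      (integrable_eval_mul_eval _ k l).const_mul _]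
  have h2 : ∀ k, ∫ ξ, ∑ l, (hartleyMatrix m J P k * Real.sqrt (lam k) *
        (hartleyMatrix m J Q l * Real.sqrt (lam l))) * (ξ k * ξ l) ∂(stdGaussianPi (EmbIdx m J)) =
      hartleyMatrix m J P k * lam k * hartleyMatrix m J Q k := by
    intro k
    rw [integral_finsetSum _ fun l _ => (integrable_eval_mul_eval _ k l).const_mul _]
    simp_rw [integral_const_mul, integral_mul_stdGaussianPi]
    rw [Finset.sum_eq_single k]
    · rw [if_pos rfl]
      have := Real.mul_self_sqrt (embEigenvalue_nonneg hm J Cext hS k)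
      change Real.sqrt (lam k) * Real.sqrt (lam k) = lam k at this
      linear_combination hartleyMatrix m J P k * hartleyMatrix m J Q k * this
    · intro l _ hl
      rw [if_neg (Ne.symm hl), mul_zero]
    · simp
  simp_rw [h2]
  have h3 := congrFun (congrFun (hartleyMatrix_mul_diagonal_mul_transpose hm J Cext) P) Q
  rw [Matrix.mul_apply] at h3
  simp only [Matrix.mul_diagonal, Matrix.transpose_apply] at h3
  rw [h3]
  -- the componentwise lags between grid points lie in `[0, 1]`, where `Cext = C`, and are at most
  -- half of the period, so the mirroring does not affect them
  change mirroredValue Cext m J _ = _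
  rw [← hC]
  have hlag : ∀ i, |(gridPoint m v.1 - gridPoint m w.1) i| =
      ((min (Nat.dist (P i) (Q i)) (2 * (m i + J i) - Nat.dist (P i) (Q i)) : ℕ) : ℝ) / m i := by
    intro i
    have hv := (v.1 i).isLt
    have hw := (w.1 i).isLt
    have hPi : (P i : ℕ) = v.1 i := rfl
    have hQi : (Q i : ℕ) = w.1 i := rfl
    have hmi : (0 : ℝ) < m i := by exact_mod_cast hm i
    rw [hPi, hQi, PiLp.sub_apply]
    change |((v.1 i : ℕ) : ℝ) / m i - ((w.1 i : ℕ) : ℝ) / m i| = _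
    rw [← sub_div, abs_div, abs_of_pos hmi]
    congr 1
    rcases le_total (v.1 i : ℕ) (w.1 i : ℕ) with h | h
    · rw [Nat.dist_eq_sub_of_le h, min_eq_left (by omega), Nat.cast_sub h, abs_sub_comm,
        abs_of_nonneg (by simpa using h)]
    · rw [Nat.dist_eq_sub_of_le_right h, min_eq_left (by omega), Nat.cast_sub h,
        abs_of_nonneg (by simpa using h)]
  rw [← hCext _ ?_]
  · simp only [hlag]
    rfl
  · intro i
    change |(gridPoint m v.1 - gridPoint m w.1) i| ∈ _
    refine ⟨abs_nonneg _, ?_⟩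
    have hmi : (0 : ℝ) < m i := by exact_mod_cast hm i
    have hb : ∀ p : GridIdx m, (gridPoint m p) i ∈ Set.Icc (0 : ℝ) 1 := by
      intro p
      change ((p i : ℕ) : ℝ) / (m i : ℝ) ∈ _
      refine ⟨by positivity, ?_⟩
      rw [div_le_one hmi]
      exact_mod_cast Nat.lt_succ_iff.1 (p i).isLt
    have h1 := hb v.1
    have h2 := hb w.1
    rw [PiLp.sub_apply, abs_le]
    constructor <;> linarith [h1.1, h1.2, h2.1, h2.2]

/-- There is a radius, depending only on the field `Z`, such that the unsmoothed samples are bounded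
by it on the vertices with probability at least `3 / 4`: they have the law of the restriction of `Z`
to the vertices, and almost every path of `Z` is bounded on the compact set `closure D`. -/
lemma exists_radius_sampleMap (D : Set (Euc d)) (hDsub : ∀ x ∈ D, ∀ i, x i ∈ Set.Icc (0 : ℝ) 1)
    (C : Euc d → ℝ) (hC : ∀ t : Euc d, C (WithLp.toLp 2 fun i => |t i|) = C t)
    {Ω₀ : Type*} [MeasurableSpace Ω₀] (P₀ : Measure Ω₀) [IsProbabilityMeasure P₀]
    (Z : closure D → Ω₀ → ℝ) (hZ : IsStationaryGaussianField P₀ D C Z) :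
    ∃ a : ℝ, 0 < a ∧ ∀ (m J : Fin d → ℕ) (hm : ∀ i, 1 ≤ m i) (Cext : Euc d → ℝ),
      (∀ t : Euc d, (∀ i, t i ∈ Set.Icc (0 : ℝ) 1) → Cext t = C t) →
      (embMatrix Cext m J).PosSemidef →
      3 / 4 ≤ ((stdGaussianPi (EmbIdx m J)).map
        (sampleMap D hm J (embEigenvalue Cext m J))) {x | ‖x‖ ≤ a} := by
  have hcomp : IsCompact (closure D) := by
    refine Metric.isCompact_of_isClosed_isBounded isClosed_closure (Bornology.IsBounded.closure ?_)
    refine (Metric.isBounded_closedBall (x := (0 : Euc d)) (r := Real.sqrt d)).subset ?_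
    intro x hx
    rw [mem_closedBall_zero_iff, EuclideanSpace.norm_eq]
    refine Real.sqrt_le_sqrt ?_
    calc ∑ i, ‖x i‖ ^ 2 ≤ ∑ i : Fin d, (1 : ℝ) := by
          refine Finset.sum_le_sum fun i _ => ?_
          rw [Real.norm_eq_abs, sq_abs]
          have := hDsub x hx i
          nlinarith [this.1, this.2]
      _ = d := by simp
  have : CompactSpace (closure D) := isCompact_iff_compactSpace.1 hcomp
  set A : ℕ → Set Ω₀ := fun n => {ω | ∀ x, |Z x ω| ≤ n} with hA
  have hAmono : Monotone A := fun n k hnk ω hω x => (hω x).trans (by exact_mod_cast hnk)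
  have hAunion : P₀ (⋃ n, A n) = 1 := by
    refine le_antisymm prob_le_one ?_
    have : P₀ {ω | Continuous fun x => Z x ω} = 1 := by
      rw [← measure_univ (μ := P₀)]
      refine measure_congr ?_
      rw [ae_eq_univ, ← mem_ae_iff]
      exact hZ.continuous
    rw [← this]
    refine measure_mono fun ω hω => ?_
    obtain ⟨B, hB⟩ := isCompact_univ.exists_bound_of_continuousOn
      (f := fun x => Z x ω) (Continuous.continuousOn hω)
    obtain ⟨n, hn⟩ := exists_nat_ge B
    exact mem_iUnion.2 ⟨n, fun x => (hB x (mem_univ x)).trans hn⟩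
  have hlim := tendsto_measure_iUnion_atTop (μ := P₀) hAmono
  rw [hAunion] at hlim
  obtain ⟨n, hn⟩ := (hlim.eventually (lt_mem_nhds three_quarters_lt_one)).exists
  refine ⟨n + 1, by positivity, fun m J hm Cext hCext hS => ?_⟩
  set X : Ω₀ → VertIdx D m → ℝ := fun ω v => Z ⟨gridPoint m v.1, v.2⟩ ω with hX
  have hXG : HasGaussianLaw X P₀ := by
    have h1 := (hZ.gaussian.comp_right
      (fun v : VertIdx D m => (⟨gridPoint m v.1, v.2⟩ : closure D))).hasGaussianLaw Finset.univ
    let L : ({v // v ∈ (Finset.univ : Finset (VertIdx D m))} → ℝ) →L[ℝ] (VertIdx D m → ℝ) :=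
      ContinuousLinearMap.pi fun v => ContinuousLinearMap.proj ⟨v, Finset.mem_univ v⟩
    exact h1.map L
  have := hXG.isGaussian_map
  have heq : (stdGaussianPi (EmbIdx m J)).map (sampleMap D hm J (embEigenvalue Cext m J)) =
      P₀.map X := by
    refine IsGaussian.ext_of_integral_mul (integral_map_sampleMap D _) ?_ fun v w => ?_
    · ext v
      rw [eval_integral (μ := P₀.map X) (f := fun x => x) (i := v) fun j =>
        (IsGaussian.integrable_id (μ := P₀.map X)).eval j,
        integral_map hXG.aemeasurable (measurable_pi_apply v).aestronglyMeasurable]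
      exact hZ.mean_eq _
    · rw [integral_sampleMap_mul D C hC hm J Cext hCext hS, integral_map hXG.aemeasurable
        (show Measurable fun x : VertIdx D m → ℝ => x v * x w from
          (measurable_pi_apply v).mul (measurable_pi_apply w)).aestronglyMeasurable]
      exact (hZ.cov_eq ⟨gridPoint m v.1, v.2⟩ ⟨gridPoint m w.1, w.2⟩).symm
  rw [heq, Measure.map_apply_of_aemeasurable hXG.aemeasurable
    (measurableSet_le (by fun_prop) (by fun_prop))]
  refine hn.le.trans (measure_mono fun ω hω => ?_)
  rw [mem_preimage, mem_ofPred_eq, pi_norm_le_iff_of_nonneg (by positivity)]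
  intro v
  exact (hω _).trans (by linarith)

end Samples

/-! ### The Poincaré inequality -/

section L2

variable {α : Type*} [MeasurableSpace α] {μ : Measure α}
  {F G : Type*} [NormedAddCommGroup F] [NormedAddCommGroup G]

lemma integrable_norm_mul_norm (f : Lp F 2 μ) (g : Lp G 2 μ) :
    Integrable (fun x => ‖f x‖ * ‖g x‖) μ :=
  (Lp.memLp f).norm.integrable_mul (Lp.memLp g).norm

variable [InnerProductSpace ℝ F] [InnerProductSpace ℝ G]

lemma integral_norm_sq_eq (f : Lp F 2 μ) : ∫ x, ‖f x‖ ^ 2 ∂μ = ‖f‖ ^ 2 := by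
  rw [← real_inner_self_eq_norm_sq f, L2.inner_def]
  simp_rw [real_inner_self_eq_norm_sq]

lemma integral_norm_mul_norm_le (f : Lp F 2 μ) (g : Lp G 2 μ) :
    ∫ x, ‖f x‖ * ‖g x‖ ∂μ ≤ ‖f‖ * ‖g‖ := by
  have h := integral_mul_norm_le_Lp_mul_Lq (μ := μ) Real.HolderConjugate.two_two
    (f := fun x => ‖f x‖) (g := fun x => ‖g x‖)
    (by simpa using (Lp.memLp f).norm) (by simpa using (Lp.memLp g).norm)
  simp only [norm_norm, Real.rpow_two, integral_norm_sq_eq] at h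
  rwa [← Real.sqrt_eq_rpow, ← Real.sqrt_eq_rpow, Real.sqrt_sq (norm_nonneg _),
    Real.sqrt_sq (norm_nonneg _)] at h

end L2

section Poincare

variable {d : ℕ} {D : Set (Euc d)}

lemma IsTest.add {φ ψ : Euc d → ℝ} (hφ : IsTest D φ) (hψ : IsTest D ψ) : IsTest D (φ + ψ) where
  smooth := hφ.smooth.add hψ.smooth
  compact := hφ.compact.add hψ.compact
  supp := (tsupport_add φ ψ).trans (union_subset hφ.supp hψ.supp)

lemma IsTest.mul_left {φ ψ : Euc d → ℝ} (hφ : IsTest D φ) (hψ : ContDiff ℝ (⊤ : ℕ∞) ψ) :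
    IsTest D (ψ * φ) where
  smooth := hψ.mul hφ.smooth
  compact := hφ.compact.mul_left
  supp := (tsupport_mul_subset_right).trans hφ.supp

lemma IsTest.zero : IsTest D (0 : Euc d → ℝ) where
  smooth := contDiff_const
  compact := HasCompactSupport.zero
  supp := by simp [tsupport]

lemma H1.fn_add (u v : H1 D) : (u + v).fn =ᵐ[volume.restrict D] u.fn + v.fn := Lp.coeFn_add _ _

lemma H1.fn_sub (u v : H1 D) : (u - v).fn =ᵐ[volume.restrict D] u.fn - v.fn := Lp.coeFn_sub _ _

lemma H1.fn_smul (c : ℝ) (u : H1 D) : (c • u).fn =ᵐ[volume.restrict D] c • u.fn :=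
  Lp.coeFn_smul _ _

lemma H1.fn_zero : (0 : H1 D).fn =ᵐ[volume.restrict D] 0 := Lp.coeFn_zero _ _ _

lemma H1.grad_sub (u v : H1 D) : (u - v).grad =ᵐ[volume.restrict D] u.grad - v.grad :=
  Lp.coeFn_sub _ _

/-- The Poincaré inequality for (classes of) test functions: integrate `∂ᵢ (xᵢ φ²)`. -/
lemma IsTest.norm_fst_le (i : Fin d) (hDsub : ∀ x ∈ D, x i ∈ Set.Icc (0 : ℝ) 1)
    (hD : MeasurableSet D) {φ : Euc d → ℝ} (hφ : IsTest D φ) (u : H1 D)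
    (hu : u.fn =ᵐ[volume.restrict D] φ) :
    ‖(u : L2Pair D).fst‖ ≤ 2 * ‖(u : L2Pair D).snd‖ := by
  set e : Euc d := EuclideanSpace.single i 1 with he
  have hcoord : ContDiff ℝ (⊤ : ℕ∞) (fun x : Euc d => x i) :=
    (EuclideanSpace.proj (𝕜 := ℝ) i).contDiff
  have hψ : IsTest D ((fun x : Euc d => x i) * φ) := hφ.mul_left hcoord
  have hφd : Differentiable ℝ φ := hφ.smooth.differentiable (by simp)
  have hψd : Differentiable ℝ ((fun x : Euc d => x i) * φ) := hψ.smooth.differentiable (by simp)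
  have hfd : ∀ x, fderiv ℝ ((fun x : Euc d => x i) * φ) x e = φ x + x i * fderiv ℝ φ x e := by
    intro x
    rw [fderiv_mul (hcoord.differentiable (by simp) x) (hφd x)]
    have : fderiv ℝ (fun x : Euc d => x i) x = EuclideanSpace.proj (𝕜 := ℝ) i :=
      (EuclideanSpace.proj (𝕜 := ℝ) i).fderiv
    simp [this, he]
    ring
  have hint : ∀ {f g : Euc d → ℝ}, Continuous f → Continuous g → HasCompactSupport g →
      Integrable (fun x => f x * g x) := fun hf hg hs =>
    (hf.mul hg).integrable_of_hasCompactSupport hs.mul_left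
  have hφ' : Continuous (fun x => fderiv ℝ φ x e) :=
    (hφ.smooth.continuous_fderiv (by simp)).clm_apply continuous_const
  have hψ' : Continuous (fun x => fderiv ℝ ((fun x : Euc d => x i) * φ) x e) :=
    (hψ.smooth.continuous_fderiv (by simp)).clm_apply continuous_const
  have hφ's : HasCompactSupport (fun x => fderiv ℝ φ x e) := hφ.compact.fderiv_apply (𝕜 := ℝ) e
  have hψ's : HasCompactSupport (fun x => fderiv ℝ ((fun x : Euc d => x i) * φ) x e) :=
    hψ.compact.fderiv_apply (𝕜 := ℝ) e
  have hi1 : Integrable (fun x => fderiv ℝ ((fun x : Euc d => x i) * φ) x e * φ x) :=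
    hint hψ' hφ.smooth.continuous hφ.compact
  have hi2 : Integrable (fun x => ((fun x : Euc d => x i) * φ) x * fderiv ℝ φ x e) :=
    hint hψ.smooth.continuous hφ' hφ's
  have hi3 : Integrable (fun x => φ x * φ x) :=
    hint hφ.smooth.continuous hφ.smooth.continuous hφ.compact
  -- integration by parts on the whole space
  have ibp : ∫ x, ((fun x : Euc d => x i) * φ) x * fderiv ℝ φ x e =
      -∫ x, fderiv ℝ ((fun x : Euc d => x i) * φ) x e * φ x :=
    integral_mul_fderiv_eq_neg_fderiv_mul_of_integrable hi1 hi2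
      (hint hψ.smooth.continuous hφ.smooth.continuous hφ.compact)
      (fun x _ => hψd x) (fun x _ => hφd x)
  have hsum : ∫ x, fderiv ℝ ((fun x : Euc d => x i) * φ) x e * φ x =
      ∫ x, φ x * φ x + ((fun x : Euc d => x i) * φ) x * fderiv ℝ φ x e := by
    refine integral_congr_ae (Filter.Eventually.of_forall fun x => ?_)
    simp only [hfd, Pi.mul_apply]; ring
  rw [integral_add hi3 hi2, ibp] at hsum
  -- the weak formulation tested with `xᵢ φ`
  have hweak := u.2 _ hψ e
  have hl : ∫ x in D, (u : L2Pair D).fst x * fderiv ℝ ((fun x : Euc d => x i) * φ) x e =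
      ∫ x, fderiv ℝ ((fun x : Euc d => x i) * φ) x e * φ x := by
    rw [← setIntegral_eq_integral_of_forall_compl_eq_zero (s := D)
      (f := fun x => fderiv ℝ ((fun x : Euc d => x i) * φ) x e * φ x)]
    · refine integral_congr_ae ?_
      filter_upwards [hu] with x hx
      change u.fn x * _ = _
      rw [hx, mul_comm]
    · intro x hx
      have : φ x = 0 := image_eq_zero_of_notMem_tsupport fun h => hx (hφ.supp h)
      rw [this, mul_zero]
  have hsq : ∫ x, φ x * φ x = ‖(u : L2Pair D).fst‖ ^ 2 := by
    rw [← integral_norm_sq_eq, ← setIntegral_eq_integral_of_forall_compl_eq_zero (s := D)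
      (f := fun x => φ x * φ x)]
    · refine integral_congr_ae ?_
      filter_upwards [hu] with x hx
      change _ = ‖u.fn x‖ ^ 2
      rw [hx, Real.norm_eq_abs, sq_abs, sq]
    · intro x hx
      have : φ x = 0 := image_eq_zero_of_notMem_tsupport fun h => hx (hφ.supp h)
      rw [this, mul_zero]
  have hr : -∫ x in D, inner ℝ ((u : L2Pair D).snd x) e * ((fun x : Euc d => x i) * φ) x ≤
      ‖(u : L2Pair D).snd‖ * ‖(u : L2Pair D).fst‖ := by
    refine (neg_le_abs _).trans ?_
    rw [← Real.norm_eq_abs]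
    refine le_trans ?_ (integral_norm_mul_norm_le _ _)
    refine norm_integral_le_of_norm_le (integrable_norm_mul_norm _ _) ?_
    filter_upwards [hu, ae_restrict_mem hD] with x hx hxD
    change _ ≤ _ * ‖u.fn x‖
    rw [hx, norm_mul, Pi.mul_apply, norm_mul]
    have h1 : ‖inner ℝ ((u : L2Pair D).snd x) e‖ ≤ ‖(u : L2Pair D).snd x‖ := by
      refine (norm_inner_le_norm _ _).trans ?_
      simp [he]
    have h2 : ‖x i‖ ≤ 1 := by
      rw [Real.norm_eq_abs, abs_le]
      constructor <;> linarith [(hDsub x hxD).1, (hDsub x hxD).2]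
    calc _ ≤ ‖(u : L2Pair D).snd x‖ * (1 * ‖φ x‖) := by gcongr
      _ = _ := by rw [one_mul]
  have hw : ∫ x in D, (u : L2Pair D).fst x * fderiv ℝ ((fun x : Euc d => x i) * φ) x e =
      -∫ x in D, inner ℝ ((u : L2Pair D).snd x) e * ((fun x : Euc d => x i) * φ) x := hweak
  rcases (norm_nonneg (u : L2Pair D).fst).eq_or_lt with h0 | hpos
  · rw [← h0]; positivity
  · nlinarith

/-- **Poincaré inequality** on `H¹₀(D)` for a domain in a strip of width one. -/
lemma norm_fst_le_of_mem_H10 (i : Fin d) (hDsub : ∀ x ∈ D, x i ∈ Set.Icc (0 : ℝ) 1)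
    (hD : MeasurableSet D) {u : H1 D} (hu : u ∈ H10 D) :
    ‖(u : L2Pair D).fst‖ ≤ 2 * ‖(u : L2Pair D).snd‖ := by
  have hclosed : IsClosed {u : H1 D | ‖(u : L2Pair D).fst‖ ≤ 2 * ‖(u : L2Pair D).snd‖} := by
    refine isClosed_le ?_ ?_
    · exact ((WithLp.prod_continuous_ofLp 2 _ _).fst.comp continuous_subtype_val).norm
    · exact continuous_const.mul
        ((WithLp.prod_continuous_ofLp 2 _ _).snd.comp continuous_subtype_val).norm
  let S : Submodule ℝ (H1 D) :=
    { carrier := {u | ∃ φ : Euc d → ℝ, IsTest D φ ∧ u.fn =ᵐ[volume.restrict D] φ}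
      zero_mem' := ⟨0, IsTest.zero, H1.fn_zero⟩
      add_mem' := by
        rintro a b ⟨φ, hφ, ha⟩ ⟨ψ, hψ, hb⟩
        exact ⟨φ + ψ, hφ.add hψ, (H1.fn_add a b).trans (ha.add hb)⟩
      smul_mem' := by
        rintro c a ⟨φ, hφ, ha⟩
        refine ⟨(fun _ => c) * φ, hφ.mul_left contDiff_const, (H1.fn_smul c a).trans ?_⟩
        filter_upwards [ha] with x hx
        simp [hx] }
  have hle : Submodule.span ℝ {u : H1 D | ∃ φ : Euc d → ℝ, IsTest D φ ∧
      u.fn =ᵐ[volume.restrict D] φ} ≤ S := Submodule.span_le.2 fun u hu => hu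
  refine closure_minimal (s := (S : Set (H1 D))) ?_ hclosed (closure_mono hle hu)
  rintro v ⟨φ, hφ, hv⟩
  exact hφ.norm_fst_le i hDsub hD v hv

lemma norm_le_of_mem_H10 (i : Fin d) (hDsub : ∀ x ∈ D, x i ∈ Set.Icc (0 : ℝ) 1)
    (hD : MeasurableSet D) {u : H1 D} (hu : u ∈ H10 D) :
    ‖u‖ ^ 2 ≤ 5 * ‖(u : L2Pair D).snd‖ ^ 2 := by
  have h := norm_fst_le_of_mem_H10 i hDsub hD hu
  rw [← Submodule.norm_coe, WithLp.prod_norm_sq_eq_of_L2]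
  nlinarith [norm_nonneg (u : L2Pair D).fst]

end Poincare

/-! ### Meshes and the assembled form -/

section Mesh

variable {d : ℕ} {D : Set (Euc d)} {m : Fin d → ℕ} {K : Geometry.SimplicialComplex ℝ (Euc d)}

lemma IsGridMesh.finite_faces (hK : IsGridMesh D m K) : K.faces.Finite := by
  have hv : K.vertices.Finite := by
    rw [hK.vertices_eq]
    exact (Set.finite_range _).inter_of_left _
  refine (hv.toFinset.powerset.finite_toSet).subset fun τ hτ => ?_
  rw [Finset.mem_coe, Finset.mem_powerset, ← Finset.coe_subset, hv.coe_toFinset,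
    Geometry.SimplicialComplex.vertices_eq]
  exact subset_biUnion_of_mem (u := fun k : Finset (Euc d) => (k : Set (Euc d))) hτ

lemma IsGridMesh.finite_elements (hK : IsGridMesh D m K) : (elements K).Finite :=
  hK.finite_faces.subset fun _ hτ => hτ.1

lemma IsGridMesh.exists_vertIdx (hK : IsGridMesh D m K) {τ : Finset (Euc d)} (hτ : τ ∈ K.faces)
    {x : Euc d} (hx : x ∈ τ) : ∃ v : VertIdx D m, gridPoint m v.1 = x := by
  have : x ∈ K.vertices := by
    rw [Geometry.SimplicialComplex.vertices_eq]
    exact mem_biUnion (t := fun k : Finset (Euc d) => (k : Set (Euc d))) hτ hx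
  rw [hK.vertices_eq] at this
  obtain ⟨⟨p, rfl⟩, hp⟩ := this
  exact ⟨⟨p, hp⟩, rfl⟩

/-- The convex hull of at most `d` points of `ℝᵈ` is a null set. -/
lemma volume_convexHull_eq_zero (τ : Finset (Euc d)) (hτ : τ.card ≤ d) :
    volume (convexHull ℝ (τ : Set (Euc d))) = 0 := by
  classical
  rcases τ.eq_empty_or_nonempty with rfl | hne
  · simp
  refine measure_mono_null (convexHull_subset_affineSpan _)
    (Measure.addHaar_affineSubspace volume _ fun htop => ?_)
  have h1 : Module.finrank ℝ (vectorSpan ℝ (τ : Set (Euc d))) = d := by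
    rw [← direction_affineSpan, htop, AffineSubspace.direction_top, finrank_top]
    simp
  have hpos := hne.card_pos
  have h2 := finrank_vectorSpan_image_finset_le ℝ (fun x : Euc d => x) τ (n := τ.card - 1)
    (by omega)
  rw [Finset.image_id', h1] at h2
  omega

lemma measurableSet_convexHull (τ : Finset (Euc d)) :
    MeasurableSet (convexHull ℝ (τ : Set (Euc d))) :=
  (τ.finite_toSet.isCompact_convexHull (𝕜 := ℝ)).isClosed.measurableSet

lemma IsGridMesh.aedisjoint_elements {σ τ : Finset (Euc d)} (hσ : σ ∈ elements K)
    (hτ : τ ∈ elements K) (hστ : σ ≠ τ) :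
    AEDisjoint volume (convexHull ℝ (σ : Set (Euc d)) ∩ D)
      (convexHull ℝ (τ : Set (Euc d)) ∩ D) := by
  classical
  refine measure_mono_null (t := convexHull ℝ ((σ ∩ τ : Finset (Euc d)) : Set (Euc d))) ?_
    (volume_convexHull_eq_zero _ ?_)
  · rw [Finset.coe_inter]
    exact fun x hx => K.inter_subset_convexHull hσ.1 hτ.1 ⟨hx.1.1, hx.2.1⟩
  · by_contra! hc
    have h1 : σ ∩ τ = σ :=
      Finset.eq_of_subset_of_card_le Finset.inter_subset_left (by rw [hσ.2]; omega)
    have h2 : σ ∩ τ = τ :=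
      Finset.eq_of_subset_of_card_le Finset.inter_subset_right (by rw [hτ.2]; omega)
    exact hστ (h1.symm.trans h2)

lemma IsGridMesh.volume_diff_elements (hK : IsGridMesh D m K) :
    volume (D \ ⋃ τ ∈ elements K, convexHull ℝ (τ : Set (Euc d))) = 0 := by
  have hnull : volume (⋃ τ ∈ {τ ∈ K.faces | τ.card ≤ d}, convexHull ℝ (τ : Set (Euc d))) = 0 := by
    rw [measure_biUnion_null_iff (hK.finite_faces.subset fun _ h => h.1).countable]
    exact fun τ hτ => volume_convexHull_eq_zero τ hτ.2
  refine measure_mono_null ?_ hnull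
  rintro x ⟨hxD, hx⟩
  have hxK : x ∈ K.space := hK.space_eq ▸ subset_closure hxD
  obtain ⟨τ, hτ, hxτ⟩ := Geometry.SimplicialComplex.mem_space_iff.1 hxK
  have hcard : τ.card ≤ d + 1 := by
    have h1 := (K.indep hτ).card_le_finrank_succ
    have h2 := Submodule.finrank_le (vectorSpan ℝ (Set.range ((↑) : τ → Euc d)))
    rw [finrank_euclideanSpace_fin] at h2
    simp only [Fintype.card_coe] at h1
    omega
  simp only [mem_iUnion, not_exists] at hx ⊢
  refine ⟨τ, ⟨hτ, ?_⟩, hxτ⟩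
  by_contra hc
  exact hx τ ⟨hτ, by omega⟩ hxτ

lemma sum_setIntegral_of_ae_partition {α ι : Type*} [MeasurableSpace α] {μ : Measure α}
    (t : Finset ι) (s : ι → Set α) {D : Set α} (hm : ∀ i ∈ t, MeasurableSet (s i))
    (hd : ∀ i ∈ t, ∀ j ∈ t, i ≠ j → AEDisjoint μ (s i) (s j)) (hsub : ∀ i ∈ t, s i ⊆ D)
    (hcover : μ (D \ ⋃ i ∈ t, s i) = 0) {F : α → ℝ} (hF : IntegrableOn F D μ) :
    ∑ i ∈ t, ∫ x in s i, F x ∂μ = ∫ x in D, F x ∂μ := by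
  have hU : (⋃ i : t, s i) = ⋃ i ∈ t, s i := by ext x; simp
  have hsub' : ⋃ i : t, s i ⊆ D := iUnion_subset fun i => hsub i i.2
  have hcover' : (⋃ i : t, s i) =ᵐ[μ] D := by
    refine hsub'.eventuallyLE.antisymm ?_
    rw [ae_le_set, hU]
    exact hcover
  rw [← setIntegral_congr_set hcover', integral_iUnion_ae (s := fun i : t => s i)
    (fun i => (hm i i.2).nullMeasurableSet)
    (fun i j hij => hd i i.2 j j.2 fun h => hij (Subtype.ext h)) (hF.mono_set hsub'), tsum_fintype]
  exact (Finset.sum_coe_sort t fun i => ∫ x in s i, F x ∂μ).symm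

/-- The elements of the mesh form a partition of `D` up to null sets. -/
lemma IsGridMesh.sum_setIntegral (hK : IsGridMesh D m K) (hD : MeasurableSet D) {F : Euc d → ℝ}
    (hF : IntegrableOn F D) :
    ∑ τ ∈ hK.finite_elements.toFinset, ∫ x in convexHull ℝ (τ : Set (Euc d)) ∩ D, F x =
      ∫ x in D, F x := by
  refine sum_setIntegral_of_ae_partition hK.finite_elements.toFinset
    (fun τ => convexHull ℝ (τ : Set (Euc d)) ∩ D)
    (fun τ _ => (measurableSet_convexHull τ).inter hD) (fun σ hσ τ hτ hne => ?_)
    (fun τ _ => inter_subset_right) (measure_mono_null ?_ hK.volume_diff_elements) hF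
  · rw [Set.Finite.mem_toFinset] at hσ hτ
    exact IsGridMesh.aedisjoint_elements hσ hτ hne
  · rintro x ⟨hxD, hx⟩
    refine ⟨hxD, fun hx' => hx ?_⟩
    simp only [mem_iUnion] at hx' ⊢
    obtain ⟨τ, hτ, hxτ⟩ := hx'
    exact ⟨τ, hK.finite_elements.mem_toFinset.2 hτ, hxτ, hxD⟩

/-- The contribution of the element `τ` to the Dirichlet form. -/
noncomputable def localForm (D : Set (Euc d)) (τ : Finset (Euc d)) (u v : H1 D) : ℝ :=
  ∫ x in convexHull ℝ (τ : Set (Euc d)) ∩ D, inner ℝ (u.grad x) (v.grad x)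

lemma H1.integrable_inner (u v : H1 D) :
    IntegrableOn (fun x => inner ℝ (u.grad x) (v.grad x)) D :=
  L2.integrable_inner (𝕜 := ℝ) (u : L2Pair D).snd (v : L2Pair D).snd

lemma localForm_sub_left (τ : Finset (Euc d)) (u u' v : H1 D) :
    localForm D τ (u - u') v = localForm D τ u v - localForm D τ u' v := by
  unfold localForm
  rw [← integral_sub ((H1.integrable_inner u v).mono_set inter_subset_right)
    ((H1.integrable_inner u' v).mono_set inter_subset_right)]
  refine integral_congr_ae ?_
  filter_upwards [ae_restrict_of_ae_restrict_of_subset inter_subset_right (H1.grad_sub u u')]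
    with x hx
  rw [hx, Pi.sub_apply, inner_sub_left]

lemma localForm_self_nonneg (τ : Finset (Euc d)) (u : H1 D) : 0 ≤ localForm D τ u u :=
  integral_nonneg fun _ => real_inner_self_nonneg

lemma IsGridMesh.sum_localForm_self (hK : IsGridMesh D m K) (hD : MeasurableSet D) (u : H1 D) :
    ∑ τ ∈ hK.finite_elements.toFinset, localForm D τ u u = ‖(u : L2Pair D).snd‖ ^ 2 := by
  unfold localForm
  rw [hK.sum_setIntegral hD (H1.integrable_inner u u), ← integral_norm_sq_eq]
  simp_rw [real_inner_self_eq_norm_sq]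
  rfl

lemma IsGridMesh.sum_abs_localForm_le (hK : IsGridMesh D m K) (hD : MeasurableSet D) (u v : H1 D) :
    ∑ τ ∈ hK.finite_elements.toFinset, |localForm D τ u v| ≤
      ‖(u : L2Pair D).snd‖ * ‖(v : L2Pair D).snd‖ := by
  have hint : IntegrableOn (fun x => ‖u.grad x‖ * ‖v.grad x‖) D :=
    integrable_norm_mul_norm (u : L2Pair D).snd (v : L2Pair D).snd
  refine le_trans ?_ (integral_norm_mul_norm_le _ _)
  change _ ≤ ∫ x in D, ‖u.grad x‖ * ‖v.grad x‖
  rw [← hK.sum_setIntegral hD hint]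
  refine Finset.sum_le_sum fun τ _ => ?_
  rw [← Real.norm_eq_abs]
  exact norm_integral_le_of_norm_le (hint.mono_set inter_subset_right)
    (Filter.Eventually.of_forall fun x => norm_inner_le_norm _ _)

lemma IsGridMesh.assembledForm_eq (hK : IsGridMesh D m K) (w : Finset (Euc d) → Euc d → ℝ)
    (k : Euc d → ℝ) (u v : H1 D) :
    assembledForm D K w k u v = ∑ τ ∈ hK.finite_elements.toFinset,
      (∑ x ∈ τ, w τ x * k x) * localForm D τ u v := by
  unfold assembledForm
  rw [finsum_mem_eq_finite_toFinset_sum _ hK.finite_elements]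
  rfl

lemma P1Space.sub_mem {u v : H1 D} (hu : u ∈ P1Space D K) (hv : v ∈ P1Space D K) :
    u - v ∈ P1Space D K := by
  obtain ⟨hu0, g, hg, hug⟩ := hu
  obtain ⟨hv0, h, hh, hvh⟩ := hv
  refine ⟨(H10 D).sub_mem hu0 hv0, g - h, fun τ hτ => ?_, (H1.fn_sub u v).trans (hug.sub hvh)⟩
  obtain ⟨A, hA⟩ := hg τ hτ
  obtain ⟨B, hB⟩ := hh τ hτ
  refine ⟨A - B, fun x hx => ?_⟩
  rw [Pi.sub_apply, hA hx, hB hx]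
  rfl

lemma abs_exp_sub_exp_le (a b : ℝ) :
    |Real.exp a - Real.exp b| ≤ Real.exp (max a b) * |a - b| := by
  wlog h : b ≤ a generalizing a b
  · rw [abs_sub_comm, max_comm, abs_sub_comm a b]
    exact this b a (le_of_not_ge h)
  rw [abs_of_nonneg (sub_nonneg.2 (Real.exp_le_exp.2 h)), max_eq_left h,
    abs_of_nonneg (sub_nonneg.2 h)]
  have h1 := Real.add_one_le_exp (b - a)
  have h2 : Real.exp b = Real.exp a * Real.exp (b - a) := by rw [← Real.exp_add]; ring_nf
  nlinarith [Real.exp_pos a]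

section Coefficients

variable {w : Finset (Euc d) → Euc d → ℝ} {z z' : VertIdx D m → ℝ} {g g' : Euc d → ℝ}

lemma IsQuadrature.exp_neg_norm_le (hw : IsQuadrature K w) (hK : IsGridMesh D m K)
    (hg : ∀ v : VertIdx D m, g (gridPoint m v.1) = z v) {τ : Finset (Euc d)} (hτ : τ ∈ elements K) :
    Real.exp (-‖z‖) ≤ ∑ x ∈ τ, w τ x * Real.exp (g x) := by
  calc Real.exp (-‖z‖) = ∑ x ∈ τ, w τ x * Real.exp (-‖z‖) := by
        rw [← Finset.sum_mul, hw.sum_eq_one τ hτ, one_mul]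
    _ ≤ _ := by
        refine Finset.sum_le_sum fun x hx => ?_
        obtain ⟨v, rfl⟩ := hK.exists_vertIdx hτ.1 hx
        rw [hg]
        refine mul_le_mul_of_nonneg_left (Real.exp_le_exp.2 ?_) (hw.nonneg τ hτ _ hx)
        exact (abs_le.1 (norm_le_pi_norm z v)).1

lemma IsQuadrature.abs_sub_le (hw : IsQuadrature K w) (hK : IsGridMesh D m K)
    (hg : ∀ v : VertIdx D m, g (gridPoint m v.1) = z v)
    (hg' : ∀ v : VertIdx D m, g' (gridPoint m v.1) = z' v)
    {τ : Finset (Euc d)} (hτ : τ ∈ elements K) :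
    |(∑ x ∈ τ, w τ x * Real.exp (g x)) - ∑ x ∈ τ, w τ x * Real.exp (g' x)| ≤
      Real.exp (‖z‖ + ‖z'‖) * ‖z - z'‖ := by
  rw [← Finset.sum_sub_distrib]
  refine (Finset.abs_sum_le_sum_abs _ _).trans ?_
  calc ∑ x ∈ τ, |w τ x * Real.exp (g x) - w τ x * Real.exp (g' x)|
      ≤ ∑ x ∈ τ, w τ x * (Real.exp (‖z‖ + ‖z'‖) * ‖z - z'‖) := by
        refine Finset.sum_le_sum fun x hx => ?_
        obtain ⟨v, rfl⟩ := hK.exists_vertIdx hτ.1 hx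
        rw [← mul_sub, abs_mul, abs_of_nonneg (hw.nonneg τ hτ _ hx), hg, hg']
        refine mul_le_mul_of_nonneg_left ?_ (hw.nonneg τ hτ _ hx)
        refine (abs_exp_sub_exp_le _ _).trans ?_
        have h1 := (abs_le.1 (norm_le_pi_norm z v)).2
        have h2 := (abs_le.1 (norm_le_pi_norm z' v)).2
        have h3 : |z v - z' v| ≤ ‖z - z'‖ := norm_le_pi_norm (z - z') v
        have h4 : max (z v) (z' v) ≤ ‖z‖ + ‖z'‖ :=
          max_le (by linarith [norm_nonneg z']) (by linarith [norm_nonneg z])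
        gcongr
    _ = _ := by rw [← Finset.sum_mul, hw.sum_eq_one τ hτ, one_mul]

/-- Coercivity of the assembled form. -/
lemma IsGridMesh.exp_neg_norm_mul_le (hK : IsGridMesh D m K) (hD : MeasurableSet D)
    (hw : IsQuadrature K w) (hg : ∀ v : VertIdx D m, g (gridPoint m v.1) = z v) (u : H1 D) :
    Real.exp (-‖z‖) * ‖(u : L2Pair D).snd‖ ^ 2 ≤
      assembledForm D K w (fun x => Real.exp (g x)) u u := by
  rw [← hK.sum_localForm_self hD, hK.assembledForm_eq, Finset.mul_sum]
  refine Finset.sum_le_sum fun τ hτ => ?_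
  rw [Set.Finite.mem_toFinset] at hτ
  exact mul_le_mul_of_nonneg_right (hw.exp_neg_norm_le hK hg hτ) (localForm_self_nonneg τ u)

/-- A priori bound for the finite element solution. -/
lemma IsFESolution.norm_grad_le (i : Fin d) (hDsub : ∀ x ∈ D, x i ∈ Set.Icc (0 : ℝ) 1)
    (hD : MeasurableSet D) (hK : IsGridMesh D m K) (hw : IsQuadrature K w)
    (hg : ∀ v : VertIdx D m, g (gridPoint m v.1) = z v) {f : H10 D →L[ℝ] ℝ} {u : H1 D}
    (hu : IsFESolution D K w f (fun x => Real.exp (g x)) u) :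
    ‖(u : L2Pair D).snd‖ ≤ Real.sqrt 5 * Real.exp ‖z‖ * ‖f‖ := by
  have h1 := hK.exp_neg_norm_mul_le hD hw hg u
  rw [hu.eq u hu.mem] at h1
  have h2 : ‖u‖ ≤ Real.sqrt 5 * ‖(u : L2Pair D).snd‖ := by
    rw [← Real.sqrt_sq (norm_nonneg (u : L2Pair D).snd), ← Real.sqrt_mul (by norm_num)]
    exact Real.le_sqrt_of_sq_le (norm_le_of_mem_H10 i hDsub hD hu.mem.1)
  -- the normed space structure of `H10 D`, a submodule of a submodule, is not found by unification
  have h3 : f ⟨u, hu.mem.1⟩ ≤ ‖f‖ * ‖u‖ := (le_abs_self _).trans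
    (@ContinuousLinearMap.le_opNorm ℝ ℝ (H10 D) ℝ _ _ _ _ (Submodule.normedSpace _) _ _ _ f _)
  have h4 : Real.exp (-‖z‖) * ‖(u : L2Pair D).snd‖ ^ 2 ≤
      ‖f‖ * (Real.sqrt 5 * ‖(u : L2Pair D).snd‖) :=
    h1.trans (h3.trans (mul_le_mul_of_nonneg_left h2 (norm_nonneg f)))
  rcases (norm_nonneg (u : L2Pair D).snd).eq_or_lt with h0 | hpos
  · rw [← h0]; positivity
  · have h5 : Real.exp (-‖z‖) * ‖(u : L2Pair D).snd‖ ≤ ‖f‖ * Real.sqrt 5 := by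
      by_contra! hc
      nlinarith
    rw [Real.exp_neg, inv_mul_le_iff₀ (Real.exp_pos _)] at h5
    linarith

/-- Perturbation estimate: finite element solutions depend Lipschitz continuously on the logarithm
of the coefficient, with a constant that does not see the mesh or the quadrature rule. -/
lemma IsFESolution.norm_sub_le (i : Fin d) (hDsub : ∀ x ∈ D, x i ∈ Set.Icc (0 : ℝ) 1)
    (hD : MeasurableSet D) (hK : IsGridMesh D m K) (hw : IsQuadrature K w)
    (hg : ∀ v : VertIdx D m, g (gridPoint m v.1) = z v)
    (hg' : ∀ v : VertIdx D m, g' (gridPoint m v.1) = z' v) {f : H10 D →L[ℝ] ℝ} {u u' : H1 D}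
    (hu : IsFESolution D K w f (fun x => Real.exp (g x)) u)
    (hu' : IsFESolution D K w f (fun x => Real.exp (g' x)) u') :
    ‖u - u'‖ ≤ 5 * ‖f‖ * Real.exp (2 * (‖z‖ + ‖z'‖)) * ‖z - z'‖ := by
  have hmem := P1Space.sub_mem hu.mem hu'.mem
  set e := u - u' with he
  have h1 := hK.exp_neg_norm_mul_le hD hw hg e
  -- Galerkin orthogonality moves the difference onto the coefficients
  have h2 : assembledForm D K w (fun x => Real.exp (g x)) e e =
      ∑ τ ∈ hK.finite_elements.toFinset, ((∑ x ∈ τ, w τ x * Real.exp (g' x)) -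
        ∑ x ∈ τ, w τ x * Real.exp (g x)) * localForm D τ u' e := by
    have hE : assembledForm D K w (fun x => Real.exp (g x)) e e =
        assembledForm D K w (fun x => Real.exp (g x)) u e -
          assembledForm D K w (fun x => Real.exp (g x)) u' e := by
      simp only [hK.assembledForm_eq]
      rw [← Finset.sum_sub_distrib]
      refine Finset.sum_congr rfl fun τ _ => ?_
      rw [← mul_sub, he, localForm_sub_left]
    rw [hE, hu.eq e hmem, ← hu'.eq e hmem]
    simp only [hK.assembledForm_eq]
    rw [← Finset.sum_sub_distrib]
    exact Finset.sum_congr rfl fun τ _ => by ring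
  have h3 : assembledForm D K w (fun x => Real.exp (g x)) e e ≤
      Real.exp (‖z‖ + ‖z'‖) * ‖z - z'‖ *
        (‖(u' : L2Pair D).snd‖ * ‖(e : L2Pair D).snd‖) := by
    rw [h2]
    refine le_trans ?_ (mul_le_mul_of_nonneg_left (hK.sum_abs_localForm_le hD u' e)
      (by positivity))
    rw [Finset.mul_sum]
    refine Finset.sum_le_sum fun τ hτ => ?_
    rw [Set.Finite.mem_toFinset] at hτ
    refine (le_abs_self _).trans ?_
    rw [abs_mul, abs_sub_comm]
    exact mul_le_mul_of_nonneg_right (hw.abs_sub_le hK hg hg' hτ) (abs_nonneg _)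
  have h4 := hu'.norm_grad_le i hDsub hD hK hw hg'
  have h5 : ‖e‖ ≤ Real.sqrt 5 * ‖(e : L2Pair D).snd‖ := by
    rw [← Real.sqrt_sq (norm_nonneg (e : L2Pair D).snd), ← Real.sqrt_mul (by norm_num)]
    exact Real.le_sqrt_of_sq_le (norm_le_of_mem_H10 i hDsub hD hmem.1)
  have h6 : ‖(e : L2Pair D).snd‖ ≤ Real.exp ‖z‖ * (Real.exp (‖z‖ + ‖z'‖) * ‖z - z'‖ *
      (Real.sqrt 5 * Real.exp ‖z'‖ * ‖f‖)) := by
    rw [← inv_mul_le_iff₀ (Real.exp_pos _), ← Real.exp_neg]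
    refine le_trans ?_ (mul_le_mul_of_nonneg_left h4 (by positivity))
    rcases (norm_nonneg (e : L2Pair D).snd).eq_or_lt with h0 | hpos
    · rw [← h0]; simp only [mul_zero]; positivity
    · by_contra! hc
      nlinarith [h1.trans h3]
  refine h5.trans ((mul_le_mul_of_nonneg_left h6 (Real.sqrt_nonneg 5)).trans_eq ?_)
  have h7 : Real.exp (2 * (‖z‖ + ‖z'‖)) =
      Real.exp ‖z‖ * Real.exp (‖z‖ + ‖z'‖) * Real.exp ‖z'‖ := by
    rw [← Real.exp_add, ← Real.exp_add]; ring_nf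
  have h8 : Real.sqrt 5 * Real.sqrt 5 = 5 := Real.mul_self_sqrt (by norm_num)
  rw [h7]
  linear_combination (Real.exp ‖z‖ * Real.exp (‖z‖ + ‖z'‖) * Real.exp ‖z'‖ * ‖z - z'‖ * ‖f‖) * h8

end Coefficients

/-- The maximum norm of a piecewise affine function is attained at the vertices. -/
lemma IsGridMesh.normC0_sub_eq (hK : IsGridMesh D m K) (hDn : D.Nonempty) {z z' : VertIdx D m → ℝ}
    {g g' : Euc d → ℝ} (hA : IsPiecewiseAffine K g) (hA' : IsPiecewiseAffine K g')
    (hg : ∀ v : VertIdx D m, g (gridPoint m v.1) = z v)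
    (hg' : ∀ v : VertIdx D m, g' (gridPoint m v.1) = z' v) :
    normC0 D (fun x => g x - g' x) = ‖z - z'‖ := by
  have hle : ∀ x : closure D, |g x - g' x| ≤ ‖z - z'‖ := by
    rintro ⟨x, hx⟩
    rw [← hK.space_eq] at hx
    obtain ⟨τ, hτ, hxτ⟩ := Geometry.SimplicialComplex.mem_space_iff.1 hx
    obtain ⟨A, hA⟩ := hA τ hτ
    obtain ⟨B, hB⟩ := hA' τ hτ
    have hconv : Convex ℝ ((A - B : Euc d →ᵃ[ℝ] ℝ) ⁻¹' Set.Icc (-‖z - z'‖) ‖z - z'‖) :=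
      (convex_Icc _ _).affine_preimage _
    have hsub : (τ : Set (Euc d)) ⊆
        (A - B : Euc d →ᵃ[ℝ] ℝ) ⁻¹' Set.Icc (-‖z - z'‖) ‖z - z'‖ := by
      intro y hy
      have hy' := subset_convexHull ℝ (τ : Set (Euc d)) hy
      obtain ⟨v, rfl⟩ := hK.exists_vertIdx hτ hy
      change A _ - B _ ∈ Set.Icc _ _
      rw [← hA hy', ← hB hy', hg, hg']
      exact abs_le.1 (norm_le_pi_norm (z - z') v)
    have := convexHull_min hsub hconv hxτ
    change A x - B x ∈ Set.Icc _ _ at this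
    rw [← hA hxτ, ← hB hxτ] at this
    exact abs_le.2 this
  have : Nonempty (closure D) := hDn.closure.to_subtype
  refine le_antisymm (ciSup_le hle) ?_
  have hbdd : BddAbove (Set.range fun x : closure D => |g x - g' x|) :=
    ⟨‖z - z'‖, by rintro _ ⟨x, rfl⟩; exact hle x⟩
  refine (pi_norm_le_iff_of_nonneg (Real.iSup_nonneg fun x => abs_nonneg _)).2 fun v => ?_
  have h := le_ciSup hbdd ⟨gridPoint m v.1, v.2⟩
  simp only [hg, hg'] at h
  exact h

end Mesh

/-! ### Moments of the samples -/

section Moments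

variable {d : ℕ} {D : Set (Euc d)} {m J : Fin d → ℕ}

/-- Changing the sign of the coordinates in `T`. -/
def signFlip {ι : Type*} [DecidableEq ι] (T : Finset ι) (x : ι → ℝ) : ι → ℝ :=
  fun k => if k ∈ T then -x k else x k

lemma measurePreserving_signFlip {ι : Type*} [Fintype ι] [DecidableEq ι] (T : Finset ι) :
    MeasurePreserving (signFlip T) (stdGaussianPi ι) (stdGaussianPi ι) := by
  refine measurePreserving_pi (fun _ : ι => gaussianReal 0 1) (fun _ : ι => gaussianReal 0 1)
    (f := fun k x => if k ∈ T then -x else x) fun k => ?_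
  by_cases hk : k ∈ T
  · simp only [hk, if_true]
    refine ⟨measurable_neg, ?_⟩
    have := gaussianReal_map_neg (μ := 0) (v := 1)
    rwa [neg_zero] at this
  · simp only [hk, if_false]
    exact MeasurePreserving.id _

/-- The smoothed sample is the average of two samples with the law of the unsmoothed one. -/
lemma sampleMap_truncate (hm : ∀ i, 1 ≤ m i) (T : Finset (EmbIdx m J)) (lam x : EmbIdx m J → ℝ) :
    sampleMap D hm J (truncate T lam) x =
      (2⁻¹ : ℝ) • (sampleMap D hm J lam x + sampleMap D hm J lam (signFlip T x)) := by
  ext v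
  simp only [Pi.smul_apply, Pi.add_apply, sampleMap_apply_eq_sum, smul_eq_mul,
    ← Finset.sum_add_distrib, Finset.mul_sum]
  refine Finset.sum_congr rfl fun k _ => ?_
  by_cases hk : k ∈ T
  · simp [truncate, signFlip, hk]
  · simp only [truncate, signFlip, hk, if_false]
    ring

lemma norm_sampleMap_truncate_le (hm : ∀ i, 1 ≤ m i) (T : Finset (EmbIdx m J))
    (lam x : EmbIdx m J → ℝ) :
    ‖sampleMap D hm J (truncate T lam) x‖ ≤
      max ‖sampleMap D hm J lam x‖ ‖sampleMap D hm J lam (signFlip T x)‖ := by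
  rw [sampleMap_truncate, norm_smul]
  have h1 := norm_add_le (sampleMap D hm J lam x) (sampleMap D hm J lam (signFlip T x))
  have h2 := le_max_left ‖sampleMap D hm J lam x‖ ‖sampleMap D hm J lam (signFlip T x)‖
  have h3 := le_max_right ‖sampleMap D hm J lam x‖ ‖sampleMap D hm J lam (signFlip T x)‖
  rw [Real.norm_of_nonneg (by norm_num)]
  linarith

/-- Fernique's bound for the exponential moment of order `t` of a centred Gaussian measure whose
ball of radius `a` has probability at least `3 / 4`. -/
noncomputable def expMomentBound (a t : ℝ) : ℝ≥0∞ :=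
  ENNReal.ofReal (Real.exp (t ^ 2 * a ^ 2 / (4 * ferniqueRate))) * ferniqueBound

lemma expMomentBound_ne_top (a t : ℝ) : expMomentBound a t ≠ ∞ :=
  ENNReal.mul_ne_top ENNReal.ofReal_ne_top ferniqueBound_ne_top

lemma lintegral_exp_sampleMap_le (hm : ∀ i, 1 ≤ m i) (lam : EmbIdx m J → ℝ) {a : ℝ} (ha : 0 < a)
    (h : 3 / 4 ≤ ((stdGaussianPi (EmbIdx m J)).map (sampleMap D hm J lam)) {x | ‖x‖ ≤ a}) (t : ℝ) :
    ∫⁻ x, ENNReal.ofReal (Real.exp (t * ‖sampleMap D hm J lam x‖)) ∂(stdGaussianPi (EmbIdx m J)) ≤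
      expMomentBound a t := by
  have key := lintegral_exp_mul_norm_le (integral_map_sampleMap D (sampleMap D hm J lam)) ha h t
  rwa [lintegral_map (by fun_prop) (by fun_prop)] at key

/-- Exponential moments of the samples, uniformly in the number of truncated eigenvalues. -/
lemma lintegral_exp_add_sampleMap_le (hm : ∀ i, 1 ≤ m i) (T : Finset (EmbIdx m J))
    (lam : EmbIdx m J → ℝ) {a : ℝ} (ha : 0 < a)
    (h : 3 / 4 ≤ ((stdGaussianPi (EmbIdx m J)).map (sampleMap D hm J lam)) {x | ‖x‖ ≤ a})
    {t : ℝ} (ht : 0 ≤ t) :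
    ∫⁻ x, ENNReal.ofReal (Real.exp (t * (‖sampleMap D hm J lam x‖ +
        ‖sampleMap D hm J (truncate T lam) x‖))) ∂(stdGaussianPi (EmbIdx m J)) ≤
      2 * expMomentBound a (2 * t) := by
  set A := sampleMap D hm J lam with hA
  have hflip : ∫⁻ x, ENNReal.ofReal (Real.exp (2 * t * ‖A (signFlip T x)‖))
      ∂(stdGaussianPi (EmbIdx m J)) = ∫⁻ x, ENNReal.ofReal (Real.exp (2 * t * ‖A x‖))
      ∂(stdGaussianPi (EmbIdx m J)) :=
    (measurePreserving_signFlip T).lintegral_comp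
      (f := fun x => ENNReal.ofReal (Real.exp (2 * t * ‖A x‖))) (by fun_prop)
  have hb := lintegral_exp_sampleMap_le hm lam ha h (2 * t)
  calc _ ≤ ∫⁻ x, (ENNReal.ofReal (Real.exp (2 * t * ‖A x‖)) +
        ENNReal.ofReal (Real.exp (2 * t * ‖A (signFlip T x)‖))) ∂(stdGaussianPi (EmbIdx m J)) := by
        refine lintegral_mono fun x => ?_
        rw [← ENNReal.ofReal_add (by positivity) (by positivity)]
        refine ENNReal.ofReal_le_ofReal ?_
        have h1 := norm_sampleMap_truncate_le (D := D) hm T lam x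
        rw [← hA] at h1
        rcases le_total ‖A x‖ ‖A (signFlip T x)‖ with hle | hle
        · rw [max_eq_right hle] at h1
          have h2 : Real.exp (t * (‖A x‖ + ‖sampleMap D hm J (truncate T lam) x‖)) ≤
              Real.exp (2 * t * ‖A (signFlip T x)‖) := Real.exp_le_exp.2 (by nlinarith)
          linarith [Real.exp_pos (2 * t * ‖A x‖)]
        · rw [max_eq_left hle] at h1
          have h2 : Real.exp (t * (‖A x‖ + ‖sampleMap D hm J (truncate T lam) x‖)) ≤
              Real.exp (2 * t * ‖A x‖) := Real.exp_le_exp.2 (by nlinarith)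
          linarith [Real.exp_pos (2 * t * ‖A (signFlip T x)‖)]
    _ = _ := lintegral_add_left (by fun_prop) _
    _ ≤ _ := by rw [hflip, two_mul (expMomentBound _ _)]; exact add_le_add hb hb

end Moments

/-! ### Measurability of the solutions and of the functional -/

/-- A real function which is continuous for the topology induced by a random vector is almost
everywhere measurable. No measurability of the range of the random vector is needed. -/
lemma aemeasurable_of_continuous_induced {Ω E : Type*} [MeasurableSpace Ω] {P : Measure Ω}
    [TopologicalSpace E] [MeasurableSpace E] [OpensMeasurableSpace E] {ξ : Ω → E}
    (hξ : AEMeasurable ξ P) {h : Ω → ℝ}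
    (hh : @Continuous Ω ℝ (TopologicalSpace.induced ξ inferInstance) _ h) :
    AEMeasurable h P := by
  refine NullMeasurable.aemeasurable ?_
  refine @measurable_of_isOpen ℝ (NullMeasurableSpace Ω P) _ _ _ _ h fun U hU => ?_
  obtain ⟨V, hV, hVU⟩ := (continuous_def.1 hh) U hU
  change NullMeasurableSet (h ⁻¹' U) P
  rw [← hVU]
  exact hξ.nullMeasurable hV.measurableSet

/-- A map with values in a metric space which is locally Lipschitz in a continuous function of `ξ`
is continuous for the topology induced by `ξ`. -/
lemma continuous_induced_of_norm_sub_le {Ω E F H : Type*} [TopologicalSpace E]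
    [NormedAddCommGroup F] [NormedAddCommGroup H] {ξ : Ω → E} {A : E → F} (hA : Continuous A)
    {u : Ω → H} {c b : ℝ} (hu : ∀ ω ω', ‖u ω - u ω'‖ ≤
      c * Real.exp (b * (‖A (ξ ω)‖ + ‖A (ξ ω')‖)) * ‖A (ξ ω) - A (ξ ω')‖) :
    @Continuous Ω H (TopologicalSpace.induced ξ inferInstance) _ u := by
  let _ : TopologicalSpace Ω := TopologicalSpace.induced ξ inferInstance
  have hξ : Continuous ξ := continuous_induced_dom
  refine continuous_iff_continuousAt.2 fun ω₀ => ?_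
  refine tendsto_iff_norm_sub_tendsto_zero.2 ?_
  have hlim : Filter.Tendsto (fun ω => c * Real.exp (b * (‖A (ξ ω)‖ + ‖A (ξ ω₀)‖)) *
      ‖A (ξ ω) - A (ξ ω₀)‖) (nhds ω₀) (nhds 0) := by
    have hc : Continuous (fun ω => c * Real.exp (b * (‖A (ξ ω)‖ + ‖A (ξ ω₀)‖)) *
      ‖A (ξ ω) - A (ξ ω₀)‖) := by fun_prop
    have := hc.tendsto ω₀
    simpa using this
  exact squeeze_zero (fun ω => norm_nonneg _) (fun ω => hu ω ω₀) hlim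

/-- The mean value formula along a segment. -/
lemma integral_lineDeriv_segment {H : Type*} [NormedAddCommGroup H] [NormedSpace ℝ H] {G : H → ℝ}
    (hG : ContDiff ℝ 1 G) (x y : H) :
    ∫ θ in (0 : ℝ)..1, lineDeriv ℝ G (x + θ • (y - x)) (y - x) = G y - G x := by
  have hd : ∀ θ : ℝ, HasDerivAt (fun θ : ℝ => G (x + θ • (y - x)))
      (lineDeriv ℝ G (x + θ • (y - x)) (y - x)) θ := by
    intro θ
    have h1 := (hG.differentiable (by simp) (x + θ • (y - x)))
    rw [h1.lineDeriv_eq_fderiv]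
    have h2 : HasDerivAt (fun θ : ℝ => x + θ • (y - x)) (y - x) θ := by
      simpa using ((hasDerivAt_id θ).smul_const (y - x)).const_add x
    exact h1.hasFDerivAt.comp_hasDerivAt θ h2
  have hc : Continuous fun θ : ℝ => lineDeriv ℝ G (x + θ • (y - x)) (y - x) := by
    have : ∀ θ : ℝ, lineDeriv ℝ G (x + θ • (y - x)) (y - x) =
        fderiv ℝ G (x + θ • (y - x)) (y - x) := fun θ =>
      (hG.differentiable (by simp) _).lineDeriv_eq_fderiv
    simp_rw [this]
    exact ((hG.continuous_fderiv (by simp)).comp (by fun_prop)).clm_apply continuous_const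
  rw [intervalIntegral.integral_eq_sub_of_hasDerivAt (fun θ _ => hd θ) (hc.intervalIntegrable _ _)]
  simp

/-- Hölder's inequality with exponents `4, 4, 2`. -/
lemma lintegral_mul_mul_le {Ω : Type*} [MeasurableSpace Ω] {P : Measure Ω} {F X Y : Ω → ℝ≥0∞}
    (hF : AEMeasurable F P) (hX : AEMeasurable X P) (hY : AEMeasurable Y P) :
    ∫⁻ ω, F ω * X ω * Y ω ∂P ≤ (∫⁻ ω, F ω ^ (4 : ℝ) ∂P) ^ (1 / 4 : ℝ) *
      (∫⁻ ω, X ω ^ (4 : ℝ) ∂P) ^ (1 / 4 : ℝ) * (∫⁻ ω, Y ω ^ (2 : ℝ) ∂P) ^ (1 / 2 : ℝ) := by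
  have h1 := ENNReal.lintegral_mul_le_Lp_mul_Lq P Real.HolderConjugate.two_two (hF.mul hX) hY
  have h2 := ENNReal.lintegral_mul_le_Lp_mul_Lq P Real.HolderConjugate.two_two
    (hF.pow_const (2 : ℝ)) (hX.pow_const (2 : ℝ))
  simp only [Pi.mul_apply, ← ENNReal.rpow_mul] at h1 h2
  norm_num at h2
  refine h1.trans (mul_le_mul_left ?_ _)
  have h3 : ∀ ω, (F ω * X ω) ^ (2 : ℝ) = F ω ^ (2 : ℝ) * X ω ^ (2 : ℝ) := fun ω =>
    ENNReal.mul_rpow_of_nonneg _ _ (by norm_num)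
  simp_rw [h3]
  have h4 := ENNReal.rpow_le_rpow h2 (by norm_num : (0 : ℝ) ≤ 1 / 2)
  rw [ENNReal.mul_rpow_of_nonneg _ _ (by norm_num), ← ENNReal.rpow_mul, ← ENNReal.rpow_mul] at h4
  norm_num at h4 ⊢
  exact h4

/-! ### The truncation error of the functional -/

/-- The constant of the error estimate: the product of bounds for the `L⁴` norms of the random
constant and of the exponential factor, and of the constant comparing Gaussian moments. -/
noncomputable def errorConst (c₀ a p M : ℝ) : ℝ≥0∞ :=
  ENNReal.ofReal (c₀ ^ p) * ((ENNReal.ofReal M ^ (4 * p)) ^ (1 / 4 : ℝ) *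
    (2 * expMomentBound a (2 * (8 * p))) ^ (1 / 4 : ℝ) *
      ENNReal.ofReal (momentConst (2 * p)) ^ (1 / 2 : ℝ))

lemma errorConst_ne_top (c₀ a : ℝ) {p : ℝ} (hp : 0 ≤ p) (M : ℝ) : errorConst c₀ a p M ≠ ∞ := by
  refine ENNReal.mul_ne_top ENNReal.ofReal_ne_top (ENNReal.mul_ne_top (ENNReal.mul_ne_top ?_ ?_) ?_)
  · exact ENNReal.rpow_ne_top_of_nonneg (by norm_num)
      (ENNReal.rpow_ne_top_of_nonneg (by positivity) ENNReal.ofReal_ne_top)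
  · exact ENNReal.rpow_ne_top_of_nonneg (by norm_num)
      (ENNReal.mul_ne_top (by simp) (expMomentBound_ne_top _ _))
  · exact ENNReal.rpow_ne_top_of_nonneg (by norm_num) ENNReal.ofReal_ne_top

/-- The error estimate, for any quantity `δ` with the bound that the perturbation estimate gives. -/
lemma lintegral_rpow_le_errorConst {d : ℕ} {D : Set (Euc d)} {m J : Fin d → ℕ}
    (hm : ∀ i, 1 ≤ m i) (T : Finset (EmbIdx m J)) (lam : EmbIdx m J → ℝ) {a : ℝ} (ha : 0 < a)
    (hball : 3 / 4 ≤ ((stdGaussianPi (EmbIdx m J)).map (sampleMap D hm J lam)) {x | ‖x‖ ≤ a})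
    {Ω : Type*} [MeasurableSpace Ω] {P : Measure Ω} {ξ : Ω → EmbIdx m J → ℝ}
    (hξ : HasLaw ξ (stdGaussianPi (EmbIdx m J)) P) {p q : ℝ} (hp : 1 ≤ p) (hq : 1 ≤ q)
    {CF δ : Ω → ℝ} {c₀ M : ℝ} (hc₀ : 0 ≤ c₀) (hCF : AEMeasurable CF P)
    (hCFM : eLpNorm CF (ENNReal.ofReal (4 * p)) P ≤ ENNReal.ofReal M) (hδ0 : ∀ ω, 0 ≤ δ ω)
    (hδ : ∀ᵐ ω ∂P, δ ω ≤ |CF ω| * (c₀ * Real.exp (2 * (‖sampleMap D hm J lam (ξ ω)‖ +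
      ‖sampleMap D hm J (truncate T lam) (ξ ω)‖)) *
        ‖sampleMap D hm J lam (ξ ω) - sampleMap D hm J (truncate T lam) (ξ ω)‖)) :
    ∫⁻ ω, ENNReal.ofReal (δ ω ^ p) ∂P ≤ errorConst c₀ a p M *
      ENNReal.ofReal ((∫ ω, ‖sampleMap D hm J lam (ξ ω) -
        sampleMap D hm J (truncate T lam) (ξ ω)‖ ^ (p * q) ∂P) ^ (1 / q)) := by
  have hp0 : 0 < p := by linarith
  set A := sampleMap D hm J lam with hA
  set A' := sampleMap D hm J (truncate T lam) with hA'
  set B := A - A' with hB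
  have hBapp : ∀ x, A x - A' x = B x := fun x => rfl
  simp only [hBapp] at hδ ⊢
  have hξm := hξ.aemeasurable
  have hBlaw : HasLaw (fun ω => B (ξ ω)) ((stdGaussianPi (EmbIdx m J)).map B) P :=
    HasLaw.fun_comp ⟨by fun_prop, rfl⟩ hξ
  set F : Ω → ℝ≥0∞ := fun ω => ENNReal.ofReal (|CF ω| ^ p) with hF
  set X : Ω → ℝ≥0∞ := fun ω => ENNReal.ofReal (Real.exp (2 * p * (‖A (ξ ω)‖ + ‖A' (ξ ω)‖))) with hX
  set Y : Ω → ℝ≥0∞ := fun ω => ENNReal.ofReal (‖B (ξ ω)‖ ^ p) with hY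
  have hFm : AEMeasurable F P := by fun_prop
  have hXm : AEMeasurable X P := by fun_prop
  have hYm : AEMeasurable Y P := by fun_prop
  have hF4 : ∫⁻ ω, F ω ^ (4 : ℝ) ∂P ≤ ENNReal.ofReal M ^ (4 * p) := by
    refine le_trans (le_of_eq ?_) (ENNReal.rpow_le_rpow hCFM (by positivity))
    rw [eLpNorm_eq_lintegral_rpow_enorm_toReal (by simpa using hp0) ENNReal.ofReal_ne_top,
      ENNReal.toReal_ofReal (by positivity), ← ENNReal.rpow_mul,
      one_div_mul_cancel (by positivity), ENNReal.rpow_one]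
    refine lintegral_congr fun ω => ?_
    rw [hF, ← ofReal_norm, Real.norm_eq_abs,
      ENNReal.ofReal_rpow_of_nonneg (by positivity) (by norm_num),
      ENNReal.ofReal_rpow_of_nonneg (by positivity) (by positivity), ← Real.rpow_mul (abs_nonneg _),
      mul_comm]
  have hX4 : ∫⁻ ω, X ω ^ (4 : ℝ) ∂P ≤ 2 * expMomentBound a (2 * (8 * p)) := by
    refine le_trans (le_of_eq ?_) (lintegral_exp_add_sampleMap_le (D := D) hm T lam ha hball
      (t := 8 * p) (by positivity))
    rw [← hξ.lintegral_comp (by fun_prop)]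
    refine lintegral_congr fun ω => ?_
    rw [hX, ENNReal.ofReal_rpow_of_nonneg (by positivity) (by norm_num), ← Real.exp_mul]
    rw [← hA, ← hA']
    ring_nf
  have hY2 : (∫⁻ ω, Y ω ^ (2 : ℝ) ∂P) ^ (1 / 2 : ℝ) ≤
      ENNReal.ofReal (momentConst (2 * p)) ^ (1 / 2 : ℝ) *
        ENNReal.ofReal ((∫ ω, ‖B (ξ ω)‖ ^ (p * q) ∂P) ^ (1 / q)) := by
    have h1 := lintegral_norm_rpow_sq_le (integral_map_sampleMap D B) hp hq
    have hpq : 0 ≤ p * q := by positivity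
    rw [← hBlaw.lintegral_comp (by fun_prop), ← hBlaw.integral_comp (by fun_prop)] at h1
    exact h1
  calc ∫⁻ ω, ENNReal.ofReal (δ ω ^ p) ∂P
      ≤ ∫⁻ ω, ENNReal.ofReal (c₀ ^ p) * (F ω * X ω * Y ω) ∂P := by
        refine lintegral_mono_ae ?_
        filter_upwards [hδ] with ω hω
        rw [hF, hX, hY, ← ENNReal.ofReal_mul (by positivity), ← ENNReal.ofReal_mul (by positivity),
          ← ENNReal.ofReal_mul (by positivity)]
        refine ENNReal.ofReal_le_ofReal ((Real.rpow_le_rpow (hδ0 ω) hω hp0.le).trans_eq ?_)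
        rw [Real.mul_rpow (by positivity) (by positivity), Real.mul_rpow (by positivity)
          (by positivity), Real.mul_rpow (by positivity) (by positivity), ← Real.exp_mul]
        ring_nf
    _ = ENNReal.ofReal (c₀ ^ p) * ∫⁻ ω, F ω * X ω * Y ω ∂P :=
        lintegral_const_mul' _ _ ENNReal.ofReal_ne_top
    _ ≤ ENNReal.ofReal (c₀ ^ p) * ((ENNReal.ofReal M ^ (4 * p)) ^ (1 / 4 : ℝ) *
        (2 * expMomentBound a (2 * (8 * p))) ^ (1 / 4 : ℝ) *
        (ENNReal.ofReal (momentConst (2 * p)) ^ (1 / 2 : ℝ) *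
        ENNReal.ofReal ((∫ ω, ‖B (ξ ω)‖ ^ (p * q) ∂P) ^ (1 / q)))) := by
        refine mul_le_mul_right ((lintegral_mul_mul_le hFm hXm hYm).trans ?_) _
        exact mul_le_mul' (mul_le_mul' (ENNReal.rpow_le_rpow hF4 (by norm_num))
          (ENNReal.rpow_le_rpow hX4 (by norm_num))) hY2
    _ = _ := by rw [errorConst]; ring

theorem mainTheorem2 {d : ℕ} (hd : 1 ≤ d)
    -- the domain: open, convex, contained in the unit cube (polygonal as it carries a mesh below)
    (D : Set (Euc d)) (hDo : IsOpen D) (hDc : Convex ℝ D) (hDn : D.Nonempty)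
    (hDsub : ∀ x ∈ D, ∀ i, x i ∈ Set.Icc (0 : ℝ) 1)
    -- the stationary Gaussian field with covariance function `C`, even in each coordinate
    (C : Euc d → ℝ) (hC : ∀ t : Euc d, C (WithLp.toLp 2 fun i => |t i|) = C t)
    {Ω₀ : Type*} [MeasurableSpace Ω₀] (P₀ : Measure Ω₀) [IsProbabilityMeasure P₀]
    (Z : closure D → Ω₀ → ℝ) (hZ : IsStationaryGaussianField P₀ D C Z)
    -- the right-hand side, the bounds on the moments of the random constant, the exponents
    (f : H10 D →L[ℝ] ℝ) (M : ℝ → ℝ) (p q : ℝ) (hp : 1 ≤ p) (hq : 1 ≤ q) :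
    ∃ c : ℝ, 0 < c ∧
      ∀ (Ω : Type*) [MeasurableSpace Ω] (P : Measure Ω) [IsProbabilityMeasure P]
        -- the grid, the padding, the extended covariance and the dropped eigenvalues
        (m J : Fin d → ℕ) (hm : ∀ i, 1 ≤ m i)
        (Cext : Euc d → ℝ) (_ : ∀ t : Euc d, (∀ i, t i ∈ Set.Icc (0 : ℝ) 1) → Cext t = C t)
        (_ : (embMatrix Cext m J).PosSemidef)
        (k : ℕ) (T : Finset (EmbIdx m J)) (_ : IsSmallest (embEigenvalue Cext m J) k T)
        (ξ : Ω → EmbIdx m J → ℝ)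
        (_ : HasLaw ξ (Measure.pi fun _ => gaussianReal 0 1) P)
        -- the mesh, the quadrature rule, the interpolants of both samples
        (K : Geometry.SimplicialComplex ℝ (Euc d)) (_ : IsGridMesh D m K)
        (w : Finset (Euc d) → Euc d → ℝ) (_ : IsQuadrature K w)
        (ZT ZT' : Ω → Euc d → ℝ)
        (_ : ∀ ω, IsInterpolant D m K (embSample hm J (embEigenvalue Cext m J) (ξ ω)) (ZT ω))
        (_ : ∀ ω, IsInterpolant D m K
          (embSample hm J (truncate T (embEigenvalue Cext m J)) (ξ ω)) (ZT' ω))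
        -- the finite element solutions for both coefficients
        (u u' : Ω → H1 D)
        (_ : ∀ ω, IsFESolution D K w f (fun x => Real.exp (ZT ω x)) (u ω))
        (_ : ∀ ω, IsFESolution D K w f (fun x => Real.exp (ZT' ω x)) (u' ω))
        -- the functional and its differentiability assumption
        (𝒢 : H1 D → ℝ) (_ : ContDiff ℝ 1 𝒢)
        (CF : Ω → ℝ) (_ : ∀ r : ℝ, 1 ≤ r → MemLp CF (ENNReal.ofReal r) P ∧
          eLpNorm CF (ENNReal.ofReal r) P ≤ ENNReal.ofReal (M r))
        (_ : ∀ᵐ ω ∂P, ∀ v ∈ H10 D,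
          |∫ θ in (0 : ℝ)..1, lineDeriv ℝ 𝒢 (u ω + θ • (u' ω - u ω)) v| ≤ CF ω * ‖v‖),
        Integrable (fun ω => |𝒢 (u ω) - 𝒢 (u' ω)| ^ p) P ∧
        Integrable (fun ω => normC0 D (fun x => ZT ω x - ZT' ω x) ^ (p * q)) P ∧
        ∫ ω, |𝒢 (u ω) - 𝒢 (u' ω)| ^ p ∂P ≤
          c * (∫ ω, normC0 D (fun x => ZT ω x - ZT' ω x) ^ (p * q) ∂P) ^ (1 / q) := by
  obtain ⟨a, ha, hball⟩ := exists_radius_sampleMap D hDsub C hC P₀ Z hZ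
  have hp0 : 0 < p := by linarith
  have hq0 : 0 < q := by linarith
  have hD := hDo.measurableSet
  set c₀ : ℝ := 5 * ‖f‖ with hc₀
  -- `errorConst` vanishes for `f = 0`; the summand `1` makes the constant positive
  refine ⟨(errorConst c₀ a p (M (4 * p))).toReal + 1, by positivity, ?_⟩
  intro Ω _ P _ m J hm Cext hCext hS k T _ ξ hξ K hK w hw ZT ZT' hZT hZT' u u' hu hu' 𝒢 h𝒢
    CF hCF hbd
  set A := sampleMap D hm J (embEigenvalue Cext m J) with hA
  set A' := sampleMap D hm J (truncate T (embEigenvalue Cext m J)) with hA'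
  have hz : ∀ ω (v : VertIdx D m), ZT ω (gridPoint m v.1) = A (ξ ω) v := fun ω v =>
    (hZT ω).interp v.1 v.2
  have hz' : ∀ ω (v : VertIdx D m), ZT' ω (gridPoint m v.1) = A' (ξ ω) v := fun ω v =>
    (hZT' ω).interp v.1 v.2
  have hnorm : ∀ ω, normC0 D (fun x => ZT ω x - ZT' ω x) = ‖A (ξ ω) - A' (ξ ω)‖ := fun ω =>
    hK.normC0_sub_eq hDn (hZT ω).affine (hZT' ω).affine (hz ω) (hz' ω)
  simp only [hnorm]
  have hstrip : ∀ x ∈ D, x (⟨0, hd⟩ : Fin d) ∈ Set.Icc (0 : ℝ) 1 := fun x hx => hDsub x hx _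
  -- no measurability of the solutions is assumed: the perturbation estimate shows that they are
  -- continuous for the topology on `Ω` induced by `ξ`
  have hmeas : AEMeasurable (fun ω => 𝒢 (u ω)) P :=
    aemeasurable_of_continuous_induced hξ.aemeasurable
      (@Continuous.comp Ω (H1 D) ℝ (.induced ξ inferInstance) _ _ _ _ h𝒢.continuous
        (continuous_induced_of_norm_sub_le A.continuous fun ω ω' => (hu ω).norm_sub_le
          _ hstrip hD hK hw (hz ω) (hz ω') (hu ω')))
  have hmeas' : AEMeasurable (fun ω => 𝒢 (u' ω)) P :=
    aemeasurable_of_continuous_induced hξ.aemeasurable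
      (@Continuous.comp Ω (H1 D) ℝ (.induced ξ inferInstance) _ _ _ _ h𝒢.continuous
        (continuous_induced_of_norm_sub_le A'.continuous fun ω ω' => (hu' ω).norm_sub_le
          _ hstrip hD hK hw (hz' ω) (hz' ω') (hu' ω')))
  have hδ : ∀ᵐ ω ∂P, |𝒢 (u ω) - 𝒢 (u' ω)| ≤ |CF ω| * (c₀ * Real.exp (2 * (‖A (ξ ω)‖ +
      ‖A' (ξ ω)‖)) * ‖A (ξ ω) - A' (ξ ω)‖) := by
    filter_upwards [hbd] with ω hω
    have h1 := hω (u' ω - u ω) ((H10 D).sub_mem (hu' ω).mem.1 (hu ω).mem.1)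
    -- for the increment `v = u' ω - u ω` the integral is the difference of the functional
    rw [integral_lineDeriv_segment h𝒢, abs_sub_comm, norm_sub_rev] at h1
    refine h1.trans (mul_le_mul (le_abs_self _) ?_ (norm_nonneg _) (abs_nonneg _))
    exact (hu ω).norm_sub_le _ hstrip hD hK hw (hz ω) (hz' ω) (hu' ω)
  have hlint := lintegral_rpow_le_errorConst hm T (embEigenvalue Cext m J) ha
    (hball m J hm Cext hCext hS) hξ hp hq (CF := CF) (c₀ := c₀) (by positivity)
    (hCF 1 le_rfl).1.aemeasurable (hCF (4 * p) (by linarith)).2 (fun ω => abs_nonneg _) hδ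
  have hfin : errorConst c₀ a p (M (4 * p)) * ENNReal.ofReal
      ((∫ ω, ‖A (ξ ω) - A' (ξ ω)‖ ^ (p * q) ∂P) ^ (1 / q)) ≠ ∞ :=
    ENNReal.mul_ne_top (errorConst_ne_top _ _ hp0.le _) ENNReal.ofReal_ne_top
  have hδm : AEStronglyMeasurable (fun ω => |𝒢 (u ω) - 𝒢 (u' ω)| ^ p) P :=
    ((hmeas.sub hmeas').abs.pow_const p).aestronglyMeasurable
  have hI : 0 ≤ ∫ ω, ‖A (ξ ω) - A' (ξ ω)‖ ^ (p * q) ∂P := integral_nonneg fun ω => by positivity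
  refine ⟨⟨hδm, ?_⟩, ?_, ?_⟩
  · refine lt_of_le_of_lt (le_of_eq ?_) (hlint.trans_lt hfin.lt_top)
    refine lintegral_congr fun ω => ?_
    rw [Real.enorm_of_nonneg (by positivity)]
  · have hBlaw : HasLaw (fun ω => (A - A') (ξ ω)) ((stdGaussianPi (EmbIdx m J)).map (A - A')) P :=
      HasLaw.fun_comp ⟨by fun_prop, rfl⟩ hξ
    have h1 := IsGaussian.integrable_norm_rpow ((stdGaussianPi (EmbIdx m J)).map (A - A'))
      (r := p * q) (by positivity)
    rw [← hBlaw.map_eq] at h1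
    exact h1.comp_aemeasurable hBlaw.aemeasurable
  · rw [integral_eq_lintegral_of_nonneg_ae (Filter.Eventually.of_forall fun ω => by positivity) hδm]
    refine (ENNReal.toReal_mono hfin hlint).trans ?_
    rw [ENNReal.toReal_mul, ENNReal.toReal_ofReal (by positivity)]
    refine mul_le_mul_of_nonneg_right (by linarith) (by positivity)
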